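/- Let $X$ be a complex Banach space and let $A:D(A)\subset X\to X$ be a densely defined closed linear operator such that, for some $\gamma\in(\pi/2,\pi)$ and with $\Sigma_\omega:=\{z\in\mathbb C\setminus\{0\}:|\arg z|<\omega\}$: (a) $\Sigma_\gamma\subset\rho(A)$; (b) for every $\varepsilon\in(0,\gamma)$ there is $C_\varepsilon>0$ with $\|(\lambda-A)^{-1}\|\le C_\varepsilon/|\lambda|$ for all $\lambda\in\Sigma_{\gamma-\varepsilon}$; (c) $0\in\rho(A)$. Let $0<\alpha<1$, $1\le q\le\infty$, and let $\mu\in\mathbb R$ satisfy $$1-\frac1{q\alpha}<\mu<1 \qquad (1/\infty:=0).$$ Let $(-A)^{\mu}$ denote the fractional power: for $\mu\le 0$ it is the usual bounded operator with domain $X$ (the identity if $\mu=0$), and for $\mu>0$ it is the inverse of the injective bounded operator $(-A)^{-\mu}$, so that $D((-A)^\mu)$ is the range of $(-A)^{-\mu}$. For $t>0$ and $a\in X$ put $$G(t)a:=\frac1{2\pi i}\int_{\Gamma}e^{\lambda t}\lambda^{\alpha-1}(\lambda^\alpha-A)^{-1}a\,d\lambda,$$ with principal powers, where $\Gamma$ comes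 in from $\infty e^{-i\gamma}$ along a ray to $\frac1t e^{-i\gamma}$, follows the arc $\frac1te^{i\theta}$, $-\gamma\le\theta\le\gamma$, and goes out along a ray to $\infty e^{i\gamma}$. For $T>0$ and $v\in L^q(0,T;X)$ let $J^\alpha v(t)=\frac1{\Gamma(\alpha)}\int_0^t(t-s)^{\alpha-1}v(s)\,ds$, let $W_{\alpha,q}(0,T;X):=J^\alpha L^q(0,T;X)$, and let $\partial_t^\alpha:=(J^\alpha)^{-1}:W_{\alpha,q}(0,T;X)\to L^q(0,T;X)$. Theorem 2.1. For every $a\in X$ and $t>0$ the integral defining $G(t)a$ converges absolutely, and $Ga-a\in L^\infty(0,\infty;X)$. If $a\in D((-A)^\mu)$, then $Ga-a\in W_{\alpha,q}(0,T;X)$ for every $T>0$, $G(t)a\in D(A)$ for every $t>0$, and $$\partial_t^\alpha(G(t)a-a)=AG(t)a\quad\text{on }(0,T)$$ for every $T>0$, as an identity in $L^q(0,T;X)$ (in particular $AGa\in L^q(0,T;X)$). -/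

import Mathlib

open MeasureTheory Set
open scoped ENNReal

noncomputable section

namespace FracEvol

variable {X : Type*} [NormedAddCommGroup X] [NormedSpace ℂ X]

/-- The open sector of half-angle `γ` about the positive real axis, without its vertex. -/
def sector (γ : ℝ) : Set ℂ := {z | z ≠ 0 ∧ |z.arg| < γ}

/-- `R` is a bounded two-sided inverse of `z - A : D(A) → X`. -/
def IsResolventAt (A : X →ₗ.[ℂ] X) (z : ℂ) (R : X →L[ℂ] X) : Prop :=
  (∀ x : X, ∃ h : R x ∈ A.domain, z • R x - A ⟨R x, h⟩ = x) ∧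
    ∀ x : A.domain, R (z • (x : X) - A x) = x

/-- The resolvent set `ρ(A)` of an unbounded operator. -/
def resolventSet (A : X →ₗ.[ℂ] X) : Set ℂ := {z | ∃ R : X →L[ℂ] X, IsResolventAt A z R}

/-- A bounded two-sided inverse is unique. -/
theorem IsResolventAt.unique {A : X →ₗ.[ℂ] X} {z : ℂ} {R S : X →L[ℂ] X}
    (hR : IsResolventAt A z R) (hS : IsResolventAt A z S) : R = S := by
  ext x
  obtain ⟨h, hx⟩ := hS.1 x
  have := hR.2 ⟨S x, h⟩
  simpa [hx] using this

open Classical in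
/-- The resolvent `(z - A)⁻¹` as a bounded operator (zero outside the resolvent set). -/
def resolventOp (A : X →ₗ.[ℂ] X) (z : ℂ) : X →L[ℂ] X :=
  if h : ∃ R : X →L[ℂ] X, IsResolventAt A z R then h.choose else 0

theorem isResolventAt_resolventOp {A : X →ₗ.[ℂ] X} {z : ℂ} (hz : z ∈ resolventSet A) :
    IsResolventAt A z (resolventOp A z) := by
  have h : ∃ R : X →L[ℂ] X, IsResolventAt A z R := hz
  rw [resolventOp, dif_pos h]
  exact h.choose_spec

/-- The standing condition on the operator `A`, with the angle `γ` made explicit. -/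
structure SectorialCondition (A : X →ₗ.[ℂ] X) (γ : ℝ) : Prop where
  closed : A.IsClosed
  dense : Dense (A.domain : Set X)
  angle_gt : Real.pi / 2 < γ
  angle_lt : γ < Real.pi
  sector_subset : sector γ ⊆ resolventSet A
  bound : ∀ ε : ℝ, 0 < ε → ε < γ → ∃ C : ℝ, 0 < C ∧
    ∀ z ∈ sector (γ - ε), ‖resolventOp A z‖ ≤ C / ‖z‖
  zero_mem : (0 : ℂ) ∈ resolventSet A

/-! Fractional powers of `-A`. -/

/-- The bounded operator `(-A)^(-θ)` for `0 < θ < 1`: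
`(sin (π θ) / π) ∫_0^∞ s^(-θ) (s - A)⁻¹ ds`. -/
def balakrishnan (A : X →ₗ.[ℂ] X) (θ : ℝ) : X →L[ℂ] X :=
  ((Real.sin (Real.pi * θ) / Real.pi : ℝ) : ℂ) •
    ∫ s in Ioi (0 : ℝ), ((s ^ (-θ) : ℝ) : ℂ) • resolventOp A (s : ℂ)

open Classical in
/-- The bounded operator `(-A)^(-β)` for `β ≥ 0`: the `⌊β⌋`-th power of `(-A)⁻¹`, composed with
`(-A)^(-θ)` for the fractional part `θ` of `β` if that is non-zero. -/
def negPow (A : X →ₗ.[ℂ] X) (β : ℝ) : X →L[ℂ] X :=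
  if Int.fract β = 0 then resolventOp A 0 ^ ⌊β⌋₊
  else resolventOp A 0 ^ ⌊β⌋₊ * balakrishnan A (Int.fract β)

open Classical in
/-- The fractional power `(-A)^μ`, `μ` real: for `μ > 0` the inverse of the injective bounded
operator `(-A)^(-μ)`, with domain the range of the latter; for `μ ≤ 0` the bounded operator
`(-A)^μ` with domain `X` (the identity for `μ = 0`). -/
def fracPow (A : X →ₗ.[ℂ] X) (μ : ℝ) : X →ₗ.[ℂ] X :=
  if 0 < μ then LinearPMap.inverse ((negPow A μ : X →ₗ[ℂ] X).toPMap ⊤)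
  else (negPow A (-μ) : X →ₗ[ℂ] X).toPMap ⊤

/-! The contour integral. -/

/-- `∫_Γ f(l) dl` over the path `Γ` which comes from `∞ e^(-iγ)` along a ray to `r e^(-iγ)`,
follows the arc `r e^(iθ)`, `θ` from `-γ` to `γ`, and leaves along the ray to `∞ e^(iγ)`. -/
def contourIntegral (γ r : ℝ) (f : ℂ → X) : X :=
  (-∫ ρ in Ioi r, Complex.exp (-(Complex.I * γ)) • f (ρ * Complex.exp (-(Complex.I * γ)))) +
  (∫ θ in (-γ)..γ, (Complex.I * r * Complex.exp (Complex.I * θ)) •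
      f (r * Complex.exp (Complex.I * θ))) +
  ∫ ρ in Ioi r, Complex.exp (Complex.I * γ) • f (ρ * Complex.exp (Complex.I * γ))

/-- Absolute convergence of the contour integral on each of the three pieces of `Γ`. -/
def ContourIntegrable (γ r : ℝ) (f : ℂ → X) : Prop :=
  IntegrableOn (fun ρ : ℝ => f (ρ * Complex.exp (-(Complex.I * γ)))) (Ioi r) ∧
  IntervalIntegrable (fun θ : ℝ => f (r * Complex.exp (Complex.I * θ))) volume (-γ) γ ∧
  IntegrableOn (fun ρ : ℝ => f (ρ * Complex.exp (Complex.I * γ))) (Ioi r)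

/-- The integrand `e^(l z) l^(α-1) (l^α - A)⁻¹ a`, with principal powers. -/
def solIntegrand (A : X →ₗ.[ℂ] X) (α : ℝ) (z : ℂ) (a : X) (l : ℂ) : X :=
  (Complex.exp (l * z) * l ^ ((α : ℂ) - 1)) • resolventOp A (l ^ (α : ℂ)) a

/-- The solution operator `G(z) a`, the path having inner radius `1 / |z|`. -/
def solOp (A : X →ₗ.[ℂ] X) (γ α : ℝ) (z : ℂ) (a : X) : X :=
  (2 * Real.pi * Complex.I : ℂ)⁻¹ • contourIntegral γ (1 / ‖z‖) (solIntegrand A α z a)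

/-! Fractional integrals and derivatives in time. -/

/-- The fractional integral `J^β v (t) = Γ(β)⁻¹ ∫_0^t (t-s)^(β-1) v(s) ds`. -/
def fracIntegral (β : ℝ) (v : ℝ → X) (t : ℝ) : X :=
  ((Real.Gamma β)⁻¹ : ℝ) • ∫ s in (0 : ℝ)..t, ((t - s) ^ (β - 1) : ℝ) • v s

/-- The graph of `∂_t^β = (J^β)⁻¹` on `(0,T)`: `w ∈ L^q(0,T;X)` and `u = J^β w` in
`L^q(0,T;X)`, that is, almost everywhere on `(0,T)`. -/
def IsFracDeriv (β : ℝ) (q : ℝ≥0∞) (T : ℝ) (u w : ℝ → X) : Prop :=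
  MemLp w q (volume.restrict (Ioo 0 T)) ∧
    u =ᵐ[volume.restrict (Ioo 0 T)] fracIntegral β w

/-- `u ∈ W_{β,q}(0,T;X) = J^β L^q(0,T;X)`. -/
def MemW (β : ℝ) (q : ℝ≥0∞) (T : ℝ) (u : ℝ → X) : Prop :=
  ∃ w : ℝ → X, IsFracDeriv β q T u w

end FracEvol

end

/-!
The solution operator is an inverse Laplace transform. For `F` holomorphic on the closed sector
`|arg z| ≤ γ` with `‖F z‖ ≤ M |z|^(δ-1)`, write `hankel γ F t` for `(2πi)⁻¹ ∫_Γ e^(zt) F(z) dz`.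
The contour integral converges absolutely, does not depend on the inner radius, and scaling
the radius as `1 / t` gives `‖hankel γ F t‖ ≤ C t^(-δ)` (`IsSectorSymbol.norm_hankel_le`).

`G(t) a` has the symbol `S(z) = z^(α-1) (z^α - A)⁻¹ a`, for which `δ = 0`; hence it is bounded.
The symbol `T(z) = z^(α-1) A (z^α - A)⁻¹ a` has `δ = α (1 - max(μ, 0))` if `a ∈ D((-A)^μ)`, by the
integral representation of `(-A)^(-μ)` (`SectorialCondition.norm_balakrishnan_le`), and the
condition on `μ` says precisely that `t^(-δ)` is in `L^q` near `0`. Since `S = A⁻¹ T`, moving the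
bounded operator `A⁻¹` out of the integral shows that `G(t) a ∈ D(A)` and `A G(t) a = hankel γ T t`,
which therefore is in `L^q(0,T;X)`.

It remains to see that `J^α (A G a) = G a - a`. As `z^(-α) T(z) = S(z) - z⁻¹ a` and `1 / z` has the
inverse transform `1` (`hankel_inv`), this is the rule
`J^α (hankel γ F) = hankel γ (z^(-α) F)` (`IsSectorSymbol.fracIntegral_hankel`). It is proved
without uniqueness of Laplace transforms: the contour is replaced by an arc of large radius `R`,
over which Fubini's theorem applies, and `J^α e^(z·)(t) - e^(zt) z^(-α) = O(|Re z|^(-β))` with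
`β < 1` (`norm_fracIntegral_exp_sub_le`) shows that the two arc integrals have the same limit.
-/

open MeasureTheory Set
open scoped ENNReal

noncomputable section

namespace FracEvol

variable {X : Type*} [NormedAddCommGroup X] [NormedSpace ℂ X]

/-! ### Resolvents -/

theorem resolvent_identity {A : X →ₗ.[ℂ] X} {z w : ℂ} (hz : z ∈ resolventSet A)
    (hw : w ∈ resolventSet A) (x : X) :
    resolventOp A z x - resolventOp A w x
      = (w - z) • resolventOp A z (resolventOp A w x) := by
  obtain ⟨h, hx⟩ := (isResolventAt_resolventOp hw).1 x
  have h1 := (isResolventAt_resolventOp hz).2 ⟨resolventOp A w x, h⟩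
  have h2 : z • resolventOp A w x - A ⟨resolventOp A w x, h⟩
      = x + (z - w) • resolventOp A w x := by
    rw [sub_eq_iff_eq_add.1 hx |> fun e => eq_sub_of_add_eq' e.symm]
    module
  simp only [h2, map_add, map_smul] at h1
  rw [sub_eq_iff_eq_add, ← neg_sub z w, neg_smul, eq_neg_add_iff_add_eq, add_comm]
  exact h1

/-- The value `A (z - A)⁻¹ x = z (z - A)⁻¹ x - x`, recovered from `A⁻¹`. -/
theorem resolventOp_eq_neg_zero {A : X →ₗ.[ℂ] X} {z : ℂ} (hz : z ∈ resolventSet A)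
    (h0 : (0 : ℂ) ∈ resolventSet A) (x : X) :
    resolventOp A z x = -resolventOp A 0 (z • resolventOp A z x - x) := by
  have h := resolvent_identity h0 hz x
  rw [sub_zero] at h
  rw [map_sub, map_smul, ← h]
  abel

theorem sector_mono {γ γ' : ℝ} (h : γ' ≤ γ) : sector γ' ⊆ sector γ :=
  fun _ hz => ⟨hz.1, hz.2.trans_le h⟩

theorem isOpen_sector {γ : ℝ} (hγ : γ ≤ Real.pi) : IsOpen (sector γ) := by
  have hs : sector γ = Complex.slitPlane ∩ {z : ℂ | |z.arg| < γ} := by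
    ext z
    simp only [sector, mem_ofPred_eq, mem_inter_iff, Complex.mem_slitPlane_iff_arg]
    constructor
    · rintro ⟨h1, h2⟩
      refine ⟨⟨fun h => ?_, h1⟩, h2⟩
      rw [h, abs_of_pos Real.pi_pos] at h2
      linarith
    · rintro ⟨⟨-, h1⟩, h2⟩
      exact ⟨h1, h2⟩
  rw [hs]
  refine ContinuousOn.isOpen_inter_preimage (f := fun z : ℂ => |z.arg|) (t := Iio γ) ?_
    Complex.isOpen_slitPlane isOpen_Iio
  exact fun z hz => (Complex.continuousAt_arg hz).abs.continuousWithinAt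

theorem SectorialCondition.continuousAt_resolventOp {A : X →ₗ.[ℂ] X} {γ : ℝ}
    (hA : SectorialCondition A γ) {w : ℂ} (hw : w ∈ sector γ) :
    ContinuousAt (resolventOp A) w := by
  have hγ : 0 < γ := by linarith [hA.angle_gt, Real.pi_pos]
  set ε := (γ - |w.arg|) / 2 with hε
  have hε0 : 0 < ε := by have := hw.2; simp only [hε]; linarith
  have hεγ : ε < γ := by have := abs_nonneg w.arg; simp only [hε]; linarith
  obtain ⟨C, hC, hb⟩ := hA.bound ε hε0 hεγ
  have hwε : w ∈ sector (γ - ε) := ⟨hw.1, by simp only [hε]; linarith [hw.2]⟩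
  have hw0 : 0 < ‖w‖ := norm_pos_iff.2 hw.1
  rw [ContinuousAt, tendsto_iff_norm_sub_tendsto_zero]
  have hlim : Filter.Tendsto (fun z : ℂ => ‖w - z‖ * (C / (‖z‖) * ‖resolventOp A w‖))
      (nhds w) (nhds 0) := by
    have : ContinuousAt (fun z : ℂ => ‖w - z‖ * (C / (‖z‖) * ‖resolventOp A w‖)) w := by
      refine ContinuousAt.mul (by fun_prop) (ContinuousAt.mul ?_ (by fun_prop))
      exact ContinuousAt.div (by fun_prop) (by fun_prop) hw0.ne'
    simpa [ContinuousAt] using this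
  refine squeeze_zero' (Filter.Eventually.of_forall fun _ => norm_nonneg _) ?_ hlim
  have ho := (isOpen_sector (by linarith [hA.angle_lt] : γ - ε ≤ Real.pi)).mem_nhds hwε
  filter_upwards [ho] with z hz
  refine ContinuousLinearMap.opNorm_le_bound _ (by positivity) fun x => ?_
  rw [sub_apply,
    resolvent_identity (hA.sector_subset (sector_mono (by linarith) hz)) (hA.sector_subset hw),
    norm_smul, mul_assoc, mul_assoc]
  gcongr
  refine ((resolventOp A z).le_opNorm _).trans ?_
  exact mul_le_mul (hb z hz) ((resolventOp A w).le_opNorm x) (norm_nonneg _) (by positivity)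

theorem SectorialCondition.differentiableAt_resolventOp {A : X →ₗ.[ℂ] X} {γ : ℝ}
    (hA : SectorialCondition A γ) {w : ℂ} (hw : w ∈ sector γ) :
    DifferentiableAt ℂ (resolventOp A) w := by
  have hs : HasDerivAt (resolventOp A) (-(resolventOp A w * resolventOp A w)) w := by
    rw [hasDerivAt_iff_tendsto_slope]
    have hc : Filter.Tendsto (fun z => -(resolventOp A z * resolventOp A w)) (nhdsWithin w {w}ᶜ)
        (nhds (-(resolventOp A w * resolventOp A w))) :=
      (((hA.continuousAt_resolventOp hw).mul continuousAt_const).neg.tendsto).mono_left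
        nhdsWithin_le_nhds
    refine hc.congr' ?_
    have ho := mem_nhdsWithin_of_mem_nhds (t := {w}ᶜ)
      ((isOpen_sector hA.angle_lt.le).mem_nhds hw)
    filter_upwards [ho, self_mem_nhdsWithin] with z hz hzw
    ext x
    have hzw' : z - w ≠ 0 := sub_ne_zero.2 hzw
    rw [slope_def_module, smul_apply, sub_apply,
      resolvent_identity (hA.sector_subset hz) (hA.sector_subset hw), smul_smul,
      neg_apply, mul_apply_eq_comp,
      show (z - w)⁻¹ * (w - z) = -1 by field_simp; ring, neg_one_smul]
  exact hs.differentiableAt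

theorem ofReal_mem_sector {γ : ℝ} (hγ : 0 < γ) {s : ℝ} (hs : 0 < s) : (s : ℂ) ∈ sector γ :=
  ⟨by exact_mod_cast hs.ne', by rwa [Complex.arg_ofReal_of_nonneg hs.le, abs_zero]⟩

/-- On a smaller sector, `‖A (z - A)⁻¹ a‖ = O(|z|^(-μ))` for `a` in the range of `(-A)^(-μ)`.
Inserting the integral which defines `a`, the bound results from
`‖A (z - A)⁻¹ (s - A)⁻¹‖ ≤ K min (1 / |z|, 1 / s)`. -/
theorem SectorialCondition.norm_balakrishnan_le {A : X →ₗ.[ℂ] X} {γ : ℝ} [CompleteSpace X]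
    (hA : SectorialCondition A γ) {ε : ℝ} (hε0 : 0 < ε) (hεγ : ε < γ) {μ : ℝ} (hμ0 : 0 < μ)
    (hμ1 : μ < 1) (b : X) :
    ∃ C : ℝ, ∀ z ∈ sector (γ - ε),
      ‖z • resolventOp A z (balakrishnan A μ b) - balakrishnan A μ b‖ ≤ C * ‖z‖ ^ (-μ) := by
  obtain ⟨C, hC, hb⟩ := hA.bound ε hε0 hεγ
  have hγ' : 0 < γ - ε := by linarith
  have hmem : ∀ s : ℝ, 0 < s → (s : ℂ) ∈ sector (γ - ε) := fun s hs => ofReal_mem_sector hγ' hs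
  have hρ : ∀ z ∈ sector (γ - ε), z ∈ resolventSet A :=
    fun z hz => hA.sector_subset (sector_mono (by linarith) hz)
  have hzR : ∀ z ∈ sector (γ - ε), ‖z • resolventOp A z - 1‖ ≤ C + 1 := by
    intro z hz
    have hz0 : 0 < ‖z‖ := norm_pos_iff.2 hz.1
    refine (norm_sub_le _ _).trans (add_le_add ?_ ContinuousLinearMap.norm_id_le)
    rw [norm_smul]
    have := hb z hz
    rwa [le_div_iff₀' hz0] at this
  set K := (C + 1) * C with hK
  have hK0 : 0 < K := by positivity
  -- the resolvent is bounded near the origin, by the resolvent identity with `A⁻¹`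
  have hR0 : ∀ s : ℝ, 0 < s → ‖resolventOp A (s : ℂ)‖ ≤ ‖resolventOp A 0‖ * (C + 1) := by
    intro s hs
    have : resolventOp A (s : ℂ)
        = -(resolventOp A 0 * ((s : ℂ) • resolventOp A (s : ℂ) - 1)) := by
      ext x
      simpa using resolventOp_eq_neg_zero (hρ _ (hmem s hs)) hA.zero_mem x
    rw [this, norm_neg]
    exact (norm_mul_le _ _).trans (by gcongr; exact hzR _ (hmem s hs))
  have hcont : ContinuousOn (fun s : ℝ => ((s ^ (-μ) : ℝ) : ℂ) • resolventOp A (s : ℂ))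
      (Ioi 0) := by
    intro s hs
    have h1 : ContinuousAt (fun s : ℝ => ((s ^ (-μ) : ℝ) : ℂ)) s :=
      Complex.continuous_ofReal.continuousAt.comp
        (Real.continuousAt_rpow_const _ _ (Or.inl (ne_of_gt hs)))
    have h2 : ContinuousAt (fun s : ℝ => resolventOp A (s : ℂ)) s :=
      ContinuousAt.comp (hA.continuousAt_resolventOp (sector_mono (by linarith) (hmem s hs)))
        Complex.continuous_ofReal.continuousAt
    exact (h1.smul h2).continuousWithinAt
  -- an integrable majorant, `O(s^(-μ))` on `(0,r]` and `O(s^(-μ-1))` beyond, and its integral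
  have hsplit : ∀ r : ℝ, 0 < r → ∀ B D : ℝ,
      IntegrableOn (fun s : ℝ => if s ≤ r then B * s ^ (-μ) else D * s ^ (-μ - 1)) (Ioi 0) ∧
      ∫ s in Ioi (0 : ℝ), (if s ≤ r then B * s ^ (-μ) else D * s ^ (-μ - 1))
        = B * (r ^ (1 - μ) / (1 - μ)) + D * (r ^ (-μ) / μ) := by
    intro r hr B D
    have e1 : EqOn (fun s : ℝ => B * s ^ (-μ))
        (fun s : ℝ => if s ≤ r then B * s ^ (-μ) else D * s ^ (-μ - 1)) (Ioc 0 r) :=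
      fun s hs => by simp [hs.2]
    have e2 : EqOn (fun s : ℝ => D * s ^ (-μ - 1))
        (fun s : ℝ => if s ≤ r then B * s ^ (-μ) else D * s ^ (-μ - 1)) (Ioi r) :=
      fun s hs => by simp [not_le.2 (mem_Ioi.1 hs)]
    have i1 : IntegrableOn (fun s : ℝ => B * s ^ (-μ)) (Ioc 0 r) :=
      ((intervalIntegrable_iff_integrableOn_Ioc_of_le hr.le).1
        (intervalIntegral.intervalIntegrable_rpow' (by linarith))).const_mul B
    have i2 : IntegrableOn (fun s : ℝ => D * s ^ (-μ - 1)) (Ioi r) :=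
      (integrableOn_Ioi_rpow_of_lt (by linarith) hr).const_mul D
    have i1' := (integrableOn_congr_fun e1 measurableSet_Ioc).1 i1
    have i2' := (integrableOn_congr_fun e2 measurableSet_Ioi).1 i2
    refine ⟨by rw [← Ioc_union_Ioi_eq_Ioi hr.le]; exact i1'.union i2', ?_⟩
    rw [← Ioc_union_Ioi_eq_Ioi hr.le,
      setIntegral_union (Ioc_disjoint_Ioi le_rfl) measurableSet_Ioi i1' i2',
      ← setIntegral_congr_fun measurableSet_Ioc e1, ← setIntegral_congr_fun measurableSet_Ioi e2,
      integral_const_mul, integral_const_mul, integral_Ioi_rpow_of_lt (by linarith) hr,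
      ← intervalIntegral.integral_of_le hr.le, integral_rpow (Or.inl (by linarith)),
      Real.zero_rpow (by linarith)]
    rw [show -μ + 1 = 1 - μ by ring, show -μ - 1 + 1 = -μ by ring, sub_zero, neg_div_neg_eq]
  have hint : IntegrableOn (fun s : ℝ => ((s ^ (-μ) : ℝ) : ℂ) • resolventOp A (s : ℂ))
      (Ioi 0) := by
    refine Integrable.mono' (hsplit 1 one_pos (‖resolventOp A 0‖ * (C + 1)) C).1
      (hcont.aestronglyMeasurable measurableSet_Ioi) ?_
    filter_upwards [self_mem_ae_restrict measurableSet_Ioi] with s hs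
    have hs : 0 < s := hs
    have hsp := Real.rpow_pos_of_pos hs (-μ)
    rw [norm_smul, Complex.norm_real, Real.norm_of_nonneg hsp.le]
    split_ifs with h
    · rw [mul_comm]
      gcongr
      exact hR0 s hs
    · have := hb _ (hmem s hs)
      rw [Complex.norm_real, Real.norm_of_nonneg hs.le] at this
      rw [Real.rpow_sub_one hs.ne', mul_div_assoc', mul_comm C, mul_div_assoc]
      gcongr
  set c : ℂ := ((Real.sin (Real.pi * μ) / Real.pi : ℝ) : ℂ) with hc
  refine ⟨‖c‖ * (K * (1 / (1 - μ) + 1 / μ) * ‖b‖), fun z hz => ?_⟩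
  have hz0 : 0 < ‖z‖ := norm_pos_iff.2 hz.1
  set L : X →L[ℂ] X := z • resolventOp A z - 1 with hL
  have hLR : ∀ s : ℝ, 0 < s → ‖L * resolventOp A (s : ℂ)‖ ≤ K / ‖z‖ ∧
      ‖L * resolventOp A (s : ℂ)‖ ≤ K / s := by
    intro s hs
    have hsC := hb _ (hmem s hs)
    rw [Complex.norm_real, Real.norm_of_nonneg hs.le] at hsC
    constructor
    · have : L * resolventOp A (s : ℂ)
          = resolventOp A z * ((s : ℂ) • resolventOp A (s : ℂ) - 1) := by
        ext x
        have h1 := resolvent_identity (hρ z hz) (hρ _ (hmem s hs)) x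
        simp only [hL, mul_apply_eq_comp, sub_apply,
          smul_apply, one_apply_eq_self, map_sub, map_smul]
        rw [sub_smul] at h1
        rw [sub_eq_iff_eq_add.1 h1]
        module
      rw [this]
      refine (norm_mul_le _ _).trans ?_
      calc _ ≤ C / ‖z‖ * (C + 1) := by
            gcongr
            · exact hb z hz
            · exact hzR _ (hmem s hs)
        _ = K / ‖z‖ := by rw [hK]; ring
    · refine (norm_mul_le _ _).trans ?_
      calc _ ≤ (C + 1) * (C / s) := by
            gcongr
            exact hzR _ hz
        _ = K / s := by rw [hK]; ring
  have hrepr : z • resolventOp A z (balakrishnan A μ b) - balakrishnan A μ b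
      = c • ∫ s in Ioi (0 : ℝ), ((s ^ (-μ) : ℝ) : ℂ) • (L * resolventOp A (s : ℂ)) b := by
    have h1 : balakrishnan A μ b
        = c • ∫ s in Ioi (0 : ℝ), ((s ^ (-μ) : ℝ) : ℂ) • resolventOp A (s : ℂ) b := by
      rw [balakrishnan, smul_apply, ContinuousLinearMap.integral_apply hint]
      rfl
    have h2 : z • resolventOp A z (balakrishnan A μ b) - balakrishnan A μ b
        = L (balakrishnan A μ b) := rfl
    have hint' : IntegrableOn (fun s : ℝ => ((s ^ (-μ) : ℝ) : ℂ) • resolventOp A (s : ℂ) b)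
        (Ioi 0) := hint.apply_continuousLinearMap b
    rw [h2, h1, map_smul, ← ContinuousLinearMap.integral_comp_comm L hint']
    simp
  rw [hrepr, norm_smul, mul_assoc]
  refine mul_le_mul_of_nonneg_left ?_ (norm_nonneg _)
  obtain ⟨hi, hv⟩ := hsplit ‖z‖ hz0 (K / ‖z‖ * ‖b‖) (K * ‖b‖)
  refine (norm_integral_le_of_norm_le hi ?_).trans (le_of_eq ?_)
  · filter_upwards [self_mem_ae_restrict measurableSet_Ioi] with s hs
    have hs : 0 < s := hs
    have hsp := Real.rpow_pos_of_pos hs (-μ)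
    rw [norm_smul, Complex.norm_real, Real.norm_of_nonneg hsp.le]
    have h3 := (L * resolventOp A (s : ℂ)).le_opNorm b
    split_ifs with h
    · rw [mul_comm]
      gcongr
      exact h3.trans (by gcongr; exact (hLR s hs).1)
    · have h4 : K * ‖b‖ * s ^ (-μ - 1) = s ^ (-μ) * (K / s * ‖b‖) := by
        rw [Real.rpow_sub_one hs.ne']; ring
      rw [h4]
      gcongr
      exact h3.trans (by gcongr; exact (hLR s hs).2)
  · rw [hv, show (1 : ℝ) - μ = -μ + 1 by ring, Real.rpow_add_one hz0.ne']
    field_simp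

/-! ### Contour integrals in a sector -/

/-- The closed sector of half-angle `γ` about the positive real axis, without its vertex. -/
def closedSector (γ : ℝ) : Set ℂ := {z | z ≠ 0 ∧ |z.arg| ≤ γ}

/-- The integral of `f` along the ray `ρ e^(iθ)`, `ρ > R`. -/
def rayIntegral (θ R : ℝ) (f : ℂ → X) : X :=
  ∫ ρ in Ioi R, Complex.exp (Complex.I * θ) • f (ρ * Complex.exp (Complex.I * θ))

/-- The integral of `f` along the arc `R e^(iθ)`, `θ` from `φ` to `ψ`. -/
def arcIntegral (φ ψ R : ℝ) (f : ℂ → X) : X :=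
  ∫ θ in φ..ψ, (Complex.I * R * Complex.exp (Complex.I * θ)) •
    f (R * Complex.exp (Complex.I * θ))

theorem contourIntegral_eq_ray_arc (γ r : ℝ) (f : ℂ → X) :
    contourIntegral γ r f
      = -rayIntegral (-γ) r f + arcIntegral (-γ) γ r f + rayIntegral γ r f := by
  simp [contourIntegral, rayIntegral, arcIntegral]

theorem norm_polar {ρ : ℝ} (hρ : 0 < ρ) (θ : ℝ) :
    ‖(ρ : ℂ) * Complex.exp (Complex.I * θ)‖ = ρ := by
  rw [norm_mul, mul_comm Complex.I, Complex.norm_exp_ofReal_mul_I, mul_one, Complex.norm_real,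
    Real.norm_of_nonneg hρ.le]

theorem re_polar (ρ θ : ℝ) :
    ((ρ : ℂ) * Complex.exp (Complex.I * θ)).re = ρ * Real.cos θ := by
  rw [mul_comm Complex.I, Complex.re_ofReal_mul, Complex.exp_ofReal_mul_I_re]

theorem arg_polar {ρ θ : ℝ} (hρ : 0 < ρ) (h1 : -Real.pi < θ) (h2 : θ ≤ Real.pi) :
    ((ρ : ℂ) * Complex.exp (Complex.I * θ)).arg = θ := by
  rw [mul_comm Complex.I, Complex.exp_mul_I, Complex.arg_mul_cos_add_sin_mul_I hρ ⟨h1, h2⟩]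

theorem polar_ne_zero {ρ : ℝ} (hρ : 0 < ρ) (θ : ℝ) :
    (ρ : ℂ) * Complex.exp (Complex.I * θ) ≠ 0 :=
  mul_ne_zero (by exact_mod_cast hρ.ne') (Complex.exp_ne_zero _)

theorem polar_mem_closedSector {γ ρ θ : ℝ} (hγ : γ < Real.pi) (hρ : 0 < ρ) (hθ : |θ| ≤ γ) :
    (ρ : ℂ) * Complex.exp (Complex.I * θ) ∈ closedSector γ := by
  refine ⟨polar_ne_zero hρ θ, ?_⟩
  rwa [arg_polar hρ (by linarith [(abs_le.1 hθ).1]) (by linarith [(abs_le.1 hθ).2])]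

/-- Cauchy's theorem on the annular sector `r ≤ ρ ≤ R`, `φ ≤ θ ≤ ψ`, which is the image of a
rectangle under `exp`. The angles are not restricted to a period. -/
theorem annular_sector_cauchy [CompleteSpace X] {f : ℂ → X} {r R φ ψ : ℝ} (hr : 0 < r)
    (hrR : r ≤ R) (hφψ : φ ≤ ψ)
    (hf : ∀ ρ ∈ Icc r R, ∀ θ ∈ Icc φ ψ,
      DifferentiableAt ℂ f ((ρ : ℂ) * Complex.exp (Complex.I * θ))) :
    (∫ ρ in r..R, Complex.exp (Complex.I * φ) • f (ρ * Complex.exp (Complex.I * φ))) -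
      (∫ ρ in r..R, Complex.exp (Complex.I * ψ) • f (ρ * Complex.exp (Complex.I * ψ))) +
      arcIntegral φ ψ R f - arcIntegral φ ψ r f = 0 := by
  have hR : 0 < R := hr.trans_le hrR
  have hlog : Real.log r ≤ Real.log R := Real.log_le_log hr hrR
  have hexp : ∀ x y : ℝ, Complex.exp (x + y * Complex.I)
      = (Real.exp x : ℂ) * Complex.exp (Complex.I * y) := fun x y => by
    rw [Complex.exp_add, Complex.ofReal_exp, mul_comm (y : ℂ)]
  set z : ℂ := Real.log r + φ * Complex.I with hz
  set w : ℂ := Real.log R + ψ * Complex.I with hw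
  have hzre : z.re = Real.log r := by simp [hz]
  have hzim : z.im = φ := by simp [hz]
  have hwre : w.re = Real.log R := by simp [hw]
  have hwim : w.im = ψ := by simp [hw]
  have hcont : ∀ θ ∈ Icc φ ψ, ContinuousOn (fun ρ : ℝ => Complex.exp (Complex.I * θ) •
      f (ρ * Complex.exp (Complex.I * θ))) (Icc r R) := by
    intro θ hθ ρ hρ
    have h := (hf ρ hρ θ hθ).continuousAt
    have h2 : ContinuousAt (fun ρ : ℝ => f (ρ * Complex.exp (Complex.I * θ))) ρ :=
      ContinuousAt.comp (f := fun ρ : ℝ => (ρ : ℂ) * Complex.exp (Complex.I * θ)) h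
        (by fun_prop)
    exact (h2.const_smul _).continuousWithinAt
  have hray : ∀ θ ∈ Icc φ ψ,
      (∫ x in Real.log r..Real.log R, Complex.exp (x + θ * Complex.I) •
        f (Complex.exp (x + θ * Complex.I)))
      = ∫ ρ in r..R, Complex.exp (Complex.I * θ) • f (ρ * Complex.exp (Complex.I * θ)) := by
    intro θ hθ
    have := intervalIntegral.integral_deriv_smul_comp' (a := Real.log r) (b := Real.log R)
      (f := Real.exp) (f' := Real.exp)
      (g := fun ρ : ℝ => Complex.exp (Complex.I * θ) • f (ρ * Complex.exp (Complex.I * θ)))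
      (fun x _ => Real.hasDerivAt_exp x) Real.continuous_exp.continuousOn
      ((hcont θ hθ).mono (by
        rw [uIcc_of_le hlog]
        rintro _ ⟨x, hx, rfl⟩
        exact ⟨(Real.log_le_iff_le_exp hr).1 hx.1, (Real.le_log_iff_exp_le hR).1 hx.2⟩))
    rw [Real.exp_log hr, Real.exp_log hR] at this
    rw [← this]
    refine intervalIntegral.integral_congr fun x _ => ?_
    simp only [hexp, Function.comp]
    rw [mul_smul, Complex.coe_smul]
  have harc : ∀ ρ : ℝ, 0 < ρ →
      Complex.I • (∫ y in φ..ψ, Complex.exp (Real.log ρ + y * Complex.I) •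
        f (Complex.exp (Real.log ρ + y * Complex.I))) = arcIntegral φ ψ ρ f := by
    intro ρ hρ
    rw [arcIntegral, ← intervalIntegral.integral_smul]
    refine intervalIntegral.integral_congr fun y _ => ?_
    simp only [hexp, Real.exp_log hρ]
    rw [smul_smul, mul_assoc]
  have hD : DifferentiableOn ℂ (fun w : ℂ => Complex.exp w • f (Complex.exp w))
      (uIcc z.re w.re ×ℂ uIcc z.im w.im) := by
    intro v hv
    rw [hzre, hwre, hzim, hwim, uIcc_of_le hlog, uIcc_of_le hφψ, Complex.mem_reProdIm] at hv
    have h := hf (Real.exp v.re) ⟨(Real.log_le_iff_le_exp hr).1 hv.1.1,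
      (Real.le_log_iff_exp_le hR).1 hv.1.2⟩ v.im hv.2
    rw [← hexp, Complex.re_add_im] at h
    exact (Complex.differentiableAt_exp.smul
      (DifferentiableAt.comp v h Complex.differentiableAt_exp)).differentiableWithinAt
  have := Complex.integral_boundary_rect_eq_zero_of_differentiableOn _ z w hD
  rw [hzre, hwre, hzim, hwim] at this
  rw [hray φ ⟨le_rfl, hφψ⟩, hray ψ ⟨hφψ, le_rfl⟩, harc R hR, harc r hr] at this
  exact this

theorem rayIntegral_eq_add {θ r R : ℝ} {f : ℂ → X} (hrR : r ≤ R)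
    (hf : IntegrableOn (fun ρ : ℝ => f (ρ * Complex.exp (Complex.I * θ))) (Ioi r)) :
    rayIntegral θ r f
      = (∫ ρ in r..R, Complex.exp (Complex.I * θ) • f (ρ * Complex.exp (Complex.I * θ)))
        + rayIntegral θ R f := by
  have h : IntegrableOn (fun ρ : ℝ => Complex.exp (Complex.I * θ) •
      f (ρ * Complex.exp (Complex.I * θ))) (Ioi r) := Integrable.smul _ hf
  exact (intervalIntegral.integral_interval_add_Ioi h (h.mono_set (Ioi_subset_Ioi hrR))).symm

/-- The contour integral does not depend on the inner radius. -/
theorem contourIntegral_radius_eq [CompleteSpace X] {f : ℂ → X} {γ : ℝ} (hγ0 : 0 ≤ γ)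
    (hγ : γ < Real.pi) (hf : ∀ z ∈ closedSector γ, DifferentiableAt ℂ f z)
    (hint : ∀ r : ℝ, 0 < r → ∀ θ : ℝ, |θ| = γ →
      IntegrableOn (fun ρ : ℝ => f (ρ * Complex.exp (Complex.I * θ))) (Ioi r))
    {r R : ℝ} (hr : 0 < r) (hR : 0 < R) : contourIntegral γ r f = contourIntegral γ R f := by
  wlog hrR : r ≤ R generalizing r R
  · exact (this hR hr (le_of_not_ge hrR)).symm
  have hC := annular_sector_cauchy (f := f) hr hrR (by linarith : -γ ≤ γ) fun ρ hρ θ hθ =>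
    hf _ (polar_mem_closedSector hγ (hr.trans_le hρ.1) (abs_le.2 hθ))
  rw [contourIntegral_eq_ray_arc, contourIntegral_eq_ray_arc,
    rayIntegral_eq_add hrR (hint r hr γ (abs_of_nonneg hγ0)),
    rayIntegral_eq_add hrR (hint r hr (-γ) (by rw [abs_neg, abs_of_nonneg hγ0])),
    ← sub_eq_zero, ← neg_eq_zero, ← hC]
  abel

theorem contourIntegral_comp_clm [CompleteSpace X] {Y : Type*} [NormedAddCommGroup Y]
    [NormedSpace ℂ Y] [CompleteSpace Y] (L : X →L[ℂ] Y) {γ r : ℝ} {f : ℂ → X}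
    (hf : ContourIntegrable γ r f) :
    contourIntegral γ r (fun z => L (f z)) = L (contourIntegral γ r f) := by
  obtain ⟨h1, h2, h3⟩ := hf
  have h1' : IntegrableOn (fun ρ : ℝ => Complex.exp (-(Complex.I * γ)) •
      f (ρ * Complex.exp (-(Complex.I * γ)))) (Ioi r) := Integrable.smul _ h1
  have h3' : IntegrableOn (fun ρ : ℝ => Complex.exp (Complex.I * γ) •
      f (ρ * Complex.exp (Complex.I * γ))) (Ioi r) := Integrable.smul _ h3
  have h2' := h2.continuousOn_smul (f := fun θ : ℝ => Complex.I * r * Complex.exp (Complex.I * θ))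
    (by fun_prop)
  rw [contourIntegral, contourIntegral, map_add, map_add, map_neg,
    ← ContinuousLinearMap.integral_comp_comm L h1',
    ← ContinuousLinearMap.integral_comp_comm L h3',
    ← ContinuousLinearMap.intervalIntegral_comp_comm L h2']
  simp

/-! ### The fractional integral of an exponential -/

theorem exp_neg_le_rpow_neg {x β : ℝ} (hx : 0 < x) (hβ0 : 0 ≤ β) (hβ1 : β ≤ 1) :
    Real.exp (-x) ≤ x ^ (-β) := by
  rw [Real.exp_neg, Real.rpow_neg hx.le]
  refine inv_anti₀ (Real.rpow_pos_of_pos hx β) ?_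
  have hexp := Real.add_one_le_exp x
  rcases le_total x 1 with h | h
  · exact (Real.rpow_le_one hx.le h hβ0).trans (by linarith)
  · exact (Real.rpow_le_rpow_of_exponent_le h hβ1).trans (by rw [Real.rpow_one]; linarith)

theorem intervalIntegrable_sub_rpow_mul_rpow {α β : ℝ} (hα : 0 < α) (hβ : β < 1) {t : ℝ}
    (ht : 0 < t) :
    IntervalIntegrable (fun s : ℝ => (t - s) ^ (α - 1) * s ^ (-β)) volume 0 t := by
  have hm : (0 : ℝ) < t / 2 := by linarith
  have i1 : IntervalIntegrable (fun s : ℝ => (t - s) ^ (α - 1) * s ^ (-β)) volume 0 (t / 2) := by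
    refine (intervalIntegral.intervalIntegrable_rpow' (by linarith)).continuousOn_mul ?_
    intro s hs
    rw [uIcc_of_le hm.le] at hs
    refine ContinuousAt.continuousWithinAt ?_
    exact ContinuousAt.rpow_const (by fun_prop) (Or.inl (by linarith [hs.2]))
  have i2 : IntervalIntegrable (fun s : ℝ => (t - s) ^ (α - 1) * s ^ (-β)) volume (t / 2) t := by
    have h : IntervalIntegrable (fun s : ℝ => (t - s) ^ (α - 1)) volume (t / 2) t := by
      have := (intervalIntegral.intervalIntegrable_rpow' (a := t / 2) (b := 0) (r := α - 1)
        (by linarith)).comp_sub_left t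
      simpa [sub_half] using this
    refine h.mul_continuousOn ?_
    intro s hs
    rw [uIcc_of_le (by linarith)] at hs
    exact (Real.continuousAt_rpow_const _ _ (Or.inl (by linarith [hs.1]))).continuousWithinAt
  exact i1.trans i2

theorem intervalIntegrable_sub_rpow {α : ℝ} (hα : 0 < α) (t : ℝ) :
    IntervalIntegrable (fun s : ℝ => (t - s) ^ (α - 1)) volume 0 t := by
  have := (intervalIntegral.intervalIntegrable_rpow' (a := t) (b := 0) (r := α - 1)
    (by linarith)).comp_sub_left t
  simpa using this

theorem integrableOn_add_rpow_mul_rpow {α β : ℝ} (hα1 : α < 1) (hαβ : α < β) (hβ : β < 1)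
    {t : ℝ} (ht : 0 < t) :
    IntegrableOn (fun v : ℝ => (t + v) ^ (α - 1) * v ^ (-β)) (Ioi 0) := by
  rw [← Ioc_union_Ioi_eq_Ioi (zero_le_one' ℝ)]
  refine IntegrableOn.union ?_ ?_
  · rw [← intervalIntegrable_iff_integrableOn_Ioc_of_le zero_le_one]
    refine (intervalIntegral.intervalIntegrable_rpow' (by linarith)).continuousOn_mul ?_
    intro s hs
    rw [uIcc_of_le zero_le_one] at hs
    refine ContinuousAt.continuousWithinAt ?_
    exact ContinuousAt.rpow_const (by fun_prop) (Or.inl (by linarith [hs.1]))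
  · refine Integrable.mono' (integrableOn_Ioi_rpow_of_lt (a := α - 1 - β) (by linarith) one_pos)
      ?_ ?_
    · refine ContinuousOn.aestronglyMeasurable ?_ measurableSet_Ioi
      intro s hs
      have hs : (1 : ℝ) < s := hs
      refine ContinuousAt.continuousWithinAt (ContinuousAt.mul ?_ ?_)
      · exact ContinuousAt.rpow_const (by fun_prop) (Or.inl (by linarith))
      · exact Real.continuousAt_rpow_const _ _ (Or.inl (by linarith))
    · filter_upwards [self_mem_ae_restrict measurableSet_Ioi] with s hs
      have hs : (1 : ℝ) < s := hs
      have hs0 : 0 < s := by linarith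
      rw [norm_mul, Real.norm_of_nonneg (by positivity), Real.norm_of_nonneg (by positivity),
        show α - 1 - β = (α - 1) + (-β) by ring, Real.rpow_add hs0]
      gcongr ?_ * _
      exact Real.rpow_le_rpow_of_nonpos hs0 (by linarith) (sub_nonpos.2 hα1.le)

/-- The Laplace transform of `u^(α-1)` in the open right half-plane, together with absolute
convergence. -/
theorem integrableOn_rpow_mul_exp_neg {α : ℝ} (hα : 0 < α) {z : ℂ} (hz : 0 < z.re) :
    IntegrableOn (fun u : ℝ => ((u ^ (α - 1) : ℝ) : ℂ) * Complex.exp (-(z * u))) (Ioi 0) ∧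
    ∫ u in Ioi (0 : ℝ), ((u ^ (α - 1) : ℝ) : ℂ) * Complex.exp (-(z * u))
      = Real.Gamma α * z ^ (-α : ℂ) := by
  constructor
  · have h := integrableOn_rpow_mul_exp_neg_mul_rpow (p := 1) (s := α - 1) (b := z.re)
      (by linarith) one_pos hz
    refine Integrable.mono' h ?_ ?_
    · refine ContinuousOn.aestronglyMeasurable ?_ measurableSet_Ioi
      intro u hu
      refine ContinuousAt.continuousWithinAt (ContinuousAt.mul ?_ (by fun_prop))
      exact Complex.continuous_ofReal.continuousAt.comp
        (Real.continuousAt_rpow_const _ _ (Or.inl (ne_of_gt hu)))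
    · filter_upwards [self_mem_ae_restrict measurableSet_Ioi] with u hu
      have hu : 0 < u := hu
      rw [norm_mul, Complex.norm_real, Real.norm_of_nonneg (by positivity), Complex.norm_exp]
      simp
  · -- both sides are analytic in `z`, and they agree on the positive real axis
    set ν : Measure ℝ := (volume.restrict (Ioi 0)).withDensity
      (fun u : ℝ => ENNReal.ofReal (u ^ (α - 1))) with hν
    have hmeas : Measurable fun u : ℝ => ENNReal.ofReal (u ^ (α - 1)) := by fun_prop
    have hfin : ∀ᵐ u ∂(volume.restrict (Ioi (0 : ℝ))), ENNReal.ofReal (u ^ (α - 1)) < ∞ :=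
      Filter.Eventually.of_forall fun _ => ENNReal.ofReal_lt_top
    have hM : ∀ w : ℂ, ProbabilityTheory.complexMGF (fun u : ℝ => -u) ν w
        = ∫ u in Ioi (0 : ℝ), ((u ^ (α - 1) : ℝ) : ℂ) * Complex.exp (-(w * u)) := by
      intro w
      rw [ProbabilityTheory.complexMGF, hν,
        integral_withDensity_eq_integral_toReal_smul hmeas hfin]
      refine setIntegral_congr_fun measurableSet_Ioi fun u hu => ?_
      have hu : 0 < u := hu
      rw [ENNReal.toReal_ofReal (by positivity), Complex.real_smul]
      push_cast
      rw [mul_neg]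
    have hsub : Ioi (0 : ℝ) ⊆ ProbabilityTheory.integrableExpSet (fun u : ℝ => -u) ν := by
      intro x hx
      have hx : 0 < x := hx
      change Integrable _ _
      rw [hν, integrable_withDensity_iff_integrable_smul' hmeas hfin]
      refine (integrable_congr ?_).1 (integrableOn_rpow_mul_exp_neg_mul_rpow (p := 1) (s := α - 1)
        (b := x) (by linarith) one_pos hx)
      filter_upwards [self_mem_ae_restrict measurableSet_Ioi] with u hu
      have hu : 0 < u := hu
      rw [ENNReal.toReal_ofReal (by positivity), smul_eq_mul, Real.rpow_one]
      ring_nf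
    have hsub' : Ioi (0 : ℝ) ⊆ interior
        (ProbabilityTheory.integrableExpSet (fun u : ℝ => -u) ν) :=
      interior_maximal hsub isOpen_Ioi
    have ha1 : AnalyticOnNhd ℂ (ProbabilityTheory.complexMGF (fun u : ℝ => -u) ν)
        {w : ℂ | 0 < w.re} :=
      ProbabilityTheory.analyticOnNhd_complexMGF.mono fun w hw => hsub' hw
    have ha2 : AnalyticOnNhd ℂ (fun w : ℂ => (Real.Gamma α : ℂ) * w ^ (-α : ℂ))
        {w : ℂ | 0 < w.re} := fun w hw =>
      analyticAt_const.mul (analyticAt_id.cpow analyticAt_const (Or.inl hw))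
    rw [← hM]
    refine ha1.eqOn_of_preconnected_of_mem_closure ha2
      (convex_halfSpace_re_gt 0).isPreconnected (z₀ := 1) (by simp) ?_ hz
    have hlim : Filter.Tendsto (fun x : ℝ => (x : ℂ)) (nhdsWithin 1 (Ioi 1)) (nhds 1) :=
      (Complex.continuous_ofReal.tendsto' 1 1 (by simp)).mono_left nhdsWithin_le_nhds
    refine mem_closure_of_tendsto hlim ?_
    filter_upwards [self_mem_nhdsWithin] with x hx
    have hx : (1 : ℝ) < x := hx
    have hx0 : 0 < x := by linarith
    refine ⟨?_, by simpa using hx.ne'⟩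
    change ProbabilityTheory.complexMGF (fun u : ℝ => -u) ν x = Real.Gamma α * (x : ℂ) ^ (-α : ℂ)
    have h := Real.integral_rpow_mul_exp_neg_mul_Ioi hα hx0
    rw [hM, ← Complex.ofReal_neg, ← Complex.ofReal_cpow hx0.le, ← Complex.ofReal_mul,
      Real.rpow_neg hx0.le, ← Real.inv_rpow hx0.le, mul_comm, ← one_div, ← h,
      ← integral_complex_ofReal]
    refine integral_congr_ae (Filter.Eventually.of_forall fun u => ?_)
    push_cast
    rfl

/-- The fractional integral over `(0,t)` of `e^(zs)` differs from `e^(zt) z^(-α)`, its analogue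
over `(-∞,t)`, by `O(|Re z|^(-β))`. In the right half-plane the difference is the integral over
`(-∞,0)`; in the left half-plane both terms are small. The bound deteriorates at the imaginary
axis only so much that it remains integrable over circular arcs. -/
theorem norm_fracIntegral_exp_sub_le {α β : ℝ} (hα0 : 0 < α) (hα1 : α < 1) (hαβ : α < β)
    (hβ : β < 1) {t : ℝ} (ht : 0 < t) :
    ∃ C : ℝ, 0 ≤ C ∧ ∀ z : ℂ, z.re ≠ 0 →
      ‖((Real.Gamma α)⁻¹ : ℝ) * (∫ s in (0 : ℝ)..t, ((t - s) ^ (α - 1) : ℝ) * Complex.exp (z * s))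
        - Complex.exp (z * t) * z ^ (-α : ℂ)‖ ≤ C * |z.re| ^ (-β) := by
  set g := (Real.Gamma α)⁻¹ with hg
  have hΓ : 0 < Real.Gamma α := Real.Gamma_pos_of_pos hα0
  have hg0 : 0 < g := inv_pos.2 hΓ
  set B := ∫ s in (0 : ℝ)..t, (t - s) ^ (α - 1) * s ^ (-β) with hB
  set B' := ∫ v in Ioi (0 : ℝ), (t + v) ^ (α - 1) * v ^ (-β) with hB'
  have hB0 : 0 ≤ B := intervalIntegral.integral_nonneg ht.le fun s hs => by
    have := hs.1
    have : 0 ≤ t - s := by linarith [hs.2]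
    positivity
  have hB'0 : 0 ≤ B' := setIntegral_nonneg measurableSet_Ioi fun v hv => by
    have : 0 < v := hv
    positivity
  refine ⟨g * B + t ^ (-(β - α)) + g * B', by positivity, fun z hz => ?_⟩
  rcases lt_or_gt_of_ne hz with hz | hz
  · have hx : 0 < |z.re| := abs_pos.2 hz.ne
    have hzn : |z.re| ≤ ‖z‖ := Complex.abs_re_le_norm z
    have hE : ‖∫ s in (0 : ℝ)..t, ((t - s) ^ (α - 1) : ℝ) * Complex.exp (z * s)‖
        ≤ B * |z.re| ^ (-β) := by
      rw [hB, ← intervalIntegral.integral_mul_const]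
      refine intervalIntegral.norm_integral_le_of_norm_le ht.le (Filter.Eventually.of_forall ?_)
        ((intervalIntegrable_sub_rpow_mul_rpow hα0 hβ ht).mul_const _)
      intro s hs
      have hs0 : 0 < s := hs.1
      have hts : 0 ≤ t - s := by linarith [hs.2]
      rw [norm_mul, Complex.norm_real, Real.norm_of_nonneg (by positivity), Complex.norm_exp,
        mul_assoc, ← Real.mul_rpow hs0.le hx.le]
      gcongr
      refine le_trans (le_of_eq ?_)
        (exp_neg_le_rpow_neg (mul_pos hs0 hx) (hα0.trans hαβ).le hβ.le)
      rw [abs_of_neg hz, Complex.re_mul_ofReal]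
      ring_nf
    have hP : ‖Complex.exp (z * t) * z ^ (-α : ℂ)‖ ≤ t ^ (-(β - α)) * |z.re| ^ (-β) := by
      rw [norm_mul, Complex.norm_exp, ← Complex.ofReal_neg, Complex.norm_cpow_real,
        show -β = -(β - α) + -α by ring, Real.rpow_add hx, ← mul_assoc, ← Real.mul_rpow ht.le hx.le]
      refine mul_le_mul ?_ ?_ (by positivity) (by positivity)
      · refine le_trans (le_of_eq ?_)
          (exp_neg_le_rpow_neg (mul_pos ht hx) (by linarith) (by linarith))
        rw [abs_of_neg hz, Complex.re_mul_ofReal]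
        ring_nf
      · exact Real.rpow_le_rpow_of_nonpos hx hzn (by linarith)
    refine (norm_sub_le _ _).trans ?_
    rw [norm_mul, Complex.norm_real, Real.norm_of_nonneg hg0.le]
    have h1 := mul_le_mul_of_nonneg_left hE hg0.le
    have h2 : 0 ≤ g * B' * |z.re| ^ (-β) := by positivity
    linarith
  · obtain ⟨hi, hv⟩ := integrableOn_rpow_mul_exp_neg hα0 hz
    have hx : |z.re| = z.re := abs_of_pos hz
    have hE : (∫ s in (0 : ℝ)..t, ((t - s) ^ (α - 1) : ℝ) * Complex.exp (z * s))
        = Complex.exp (z * t) *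
          ∫ u in (0 : ℝ)..t, ((u ^ (α - 1) : ℝ) : ℂ) * Complex.exp (-(z * u)) := by
      have := intervalIntegral.integral_comp_sub_left (a := 0) (b := t)
        (fun u : ℝ => Complex.exp (z * t) *
          (((u ^ (α - 1) : ℝ) : ℂ) * Complex.exp (-(z * u)))) t
      rw [sub_self, sub_zero] at this
      rw [← intervalIntegral.integral_const_mul, ← this]
      refine intervalIntegral.integral_congr fun s _ => ?_
      rw [mul_left_comm, ← Complex.exp_add]
      push_cast
      ring_nf
    have hsplit := intervalIntegral.integral_interval_add_Ioi (a := 0) (b := t) hi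
      (hi.mono_set (Ioi_subset_Ioi ht.le))
    rw [hv] at hsplit
    have hD : (g : ℂ) * (∫ s in (0 : ℝ)..t, ((t - s) ^ (α - 1) : ℝ) * Complex.exp (z * s))
        - Complex.exp (z * t) * z ^ (-α : ℂ)
        = -((g : ℂ) * ∫ v in Ioi (0 : ℝ), (((t + v) ^ (α - 1) : ℝ) : ℂ) *
            Complex.exp (-(z * v))) := by
      have hshift : Complex.exp (z * t) *
            (∫ u in Ioi t, ((u ^ (α - 1) : ℝ) : ℂ) * Complex.exp (-(z * u)))
          = ∫ v in Ioi (0 : ℝ), (((t + v) ^ (α - 1) : ℝ) : ℂ) * Complex.exp (-(z * v)) := by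
        rw [← integral_const_mul]
        have := (measurePreserving_add_left volume t).setIntegral_preimage_emb
          (measurableEmbedding_addLeft t) (fun u : ℝ => Complex.exp (z * t) *
          (((u ^ (α - 1) : ℝ) : ℂ) * Complex.exp (-(z * u)))) (Ioi t)
        rw [preimage_const_add_Ioi, sub_self] at this
        rw [← this]
        refine setIntegral_congr_fun measurableSet_Ioi fun v _ => ?_
        rw [mul_left_comm, ← Complex.exp_add]
        push_cast
        ring_nf
      have hgΓ : (g : ℂ) * (Real.Gamma α : ℂ) = 1 := by
        rw [← Complex.ofReal_mul, hg, inv_mul_cancel₀ hΓ.ne', Complex.ofReal_one]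
      rw [hE, ← hshift]
      linear_combination (g : ℂ) * Complex.exp (z * t) * hsplit
        + (Complex.exp (z * t) * z ^ (-α : ℂ)) * hgΓ
    rw [hD, norm_neg, norm_mul, Complex.norm_real, Real.norm_of_nonneg hg0.le]
    have hN : ‖∫ v in Ioi (0 : ℝ), (((t + v) ^ (α - 1) : ℝ) : ℂ) * Complex.exp (-(z * v))‖
        ≤ B' * |z.re| ^ (-β) := by
      rw [hB', ← integral_mul_const]
      refine norm_integral_le_of_norm_le
        ((integrableOn_add_rpow_mul_rpow hα1 hαβ hβ ht).mul_const _) ?_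
      filter_upwards [self_mem_ae_restrict measurableSet_Ioi] with v hv
      have hv : 0 < v := hv
      rw [norm_mul, Complex.norm_real, Real.norm_of_nonneg (by positivity), Complex.norm_exp,
        mul_assoc, hx, ← Real.mul_rpow hv.le hz.le]
      gcongr
      refine le_trans (le_of_eq ?_)
        (exp_neg_le_rpow_neg (mul_pos hv hz) (hα0.trans hαβ).le hβ.le)
      rw [Complex.neg_re, Complex.re_mul_ofReal]
      ring_nf
    have h1 := mul_le_mul_of_nonneg_left hN hg0.le
    have h2 : 0 ≤ (g * B + t ^ (-(β - α))) * |z.re| ^ (-β) := by positivity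
    linarith

theorem intervalIntegrable_abs_sub_rpow {r : ℝ} (hr : -1 < r) (c a b : ℝ) :
    IntervalIntegrable (fun x : ℝ => |x - c| ^ r) volume a b := by
  have h0 : ∀ b : ℝ, 0 ≤ b → IntervalIntegrable (fun x : ℝ => |x| ^ r) volume 0 b := by
    intro b hb
    refine (intervalIntegral.intervalIntegrable_rpow' hr).congr fun x hx => ?_
    rw [uIoc_of_le hb] at hx
    simp only [abs_of_pos hx.1]
  have h1 : ∀ b : ℝ, IntervalIntegrable (fun x : ℝ => |x| ^ r) volume 0 b := by
    intro b
    rcases le_total 0 b with hb | hb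
    · exact h0 b hb
    · have := (IntervalIntegrable.iff_comp_neg (f := fun x : ℝ => |x| ^ r) (a := 0) (b := b)).2
      simp only [abs_neg, neg_zero] at this
      exact this (h0 (-b) (by linarith))
  have h2 := ((h1 (a - c)).symm.trans (h1 (b - c))).comp_sub_right c
  simpa using h2

/-- `|cos θ|^(-β)` is integrable over a period if `β < 1`. -/
theorem intervalIntegrable_abs_cos_rpow {β γ : ℝ} (hβ0 : 0 < β) (hβ : β < 1) (hγ0 : 0 ≤ γ)
    (hγ : γ ≤ Real.pi) :
    IntervalIntegrable (fun θ : ℝ => |Real.cos θ| ^ (-β)) volume (-γ) γ := by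
  have hπ := Real.pi_pos
  have h1 := intervalIntegrable_abs_sub_rpow (r := -β) (by linarith) (Real.pi / 2) (-γ) γ
  have h2 := intervalIntegrable_abs_sub_rpow (r := -β) (by linarith) (-(Real.pi / 2)) (-γ) γ
  refine ((h1.add h2).const_mul ((2 / Real.pi) ^ (-β))).mono_fun ?_ ?_
  · exact (Measurable.pow_const (by fun_prop) _).aestronglyMeasurable
  · refine (ae_restrict_iff' measurableSet_uIoc).2 (Filter.Eventually.of_forall fun θ hθ => ?_)
    rw [uIoc_of_le (by linarith)] at hθ
    have hnn : ∀ x : ℝ, 0 ≤ |x| ^ (-β) := fun x => Real.rpow_nonneg (abs_nonneg x) _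
    beta_reduce
    rw [Real.norm_of_nonneg (hnn _), Real.norm_of_nonneg (by
      have := hnn (θ - Real.pi / 2); have := hnn (θ - -(Real.pi / 2)); positivity)]
    have key : ∀ x : ℝ, |x| ≤ Real.pi / 2 → |Real.sin x| ^ (-β)
        ≤ (2 / Real.pi) ^ (-β) * |x| ^ (-β) := by
      intro x hx
      rcases eq_or_ne x 0 with rfl | hx0
      · simp [Real.zero_rpow (by linarith : -β ≠ 0)]
      rw [← Real.mul_rpow (by positivity) (abs_nonneg x)]
      refine Real.rpow_le_rpow_of_nonpos (by positivity) ?_ (by linarith)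
      rw [Real.abs_sin_eq_sin_abs_of_abs_le_pi (by linarith)]
      exact Real.mul_le_sin (abs_nonneg x) hx
    rcases le_total 0 θ with h | h
    · have := key (θ - Real.pi / 2) (abs_le.2 ⟨by linarith, by linarith [hθ.2]⟩)
      rw [Real.sin_sub_pi_div_two, abs_neg] at this
      refine this.trans ?_
      gcongr
      linarith [hnn (θ - -(Real.pi / 2))]
    · have := key (θ - -(Real.pi / 2)) (abs_le.2 ⟨by linarith [hθ.1], by linarith⟩)
      rw [sub_neg_eq_add, Real.sin_add_pi_div_two] at this
      refine this.trans ?_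
      gcongr
      rw [sub_neg_eq_add]
      linarith [hnn (θ - Real.pi / 2)]

/-! ### The inverse Laplace transform over the contour -/

/-- `F` is holomorphic on the closed sector of half-angle `γ` (without vertex), and of size
`M |z|^(δ-1)` there. -/
structure IsSectorSymbol (γ δ M : ℝ) (F : ℂ → X) : Prop where
  differentiableAt : ∀ z ∈ closedSector γ, DifferentiableAt ℂ F z
  norm_le : ∀ z ∈ closedSector γ, ‖F z‖ ≤ M * ‖z‖ ^ (δ - 1)

/-- The inverse Laplace transform `(2πi)⁻¹ ∫_Γ e^(zt) F(z) dz`, the contour having inner radius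
`1 / t`. -/
def hankel (γ : ℝ) (F : ℂ → X) (t : ℝ) : X :=
  (2 * Real.pi * Complex.I : ℂ)⁻¹ • contourIntegral γ (1 / t) (fun z => Complex.exp (z * t) • F z)

theorem norm_exp_polar_mul (ρ θ t : ℝ) :
    ‖Complex.exp ((ρ : ℂ) * Complex.exp (Complex.I * θ) * t)‖
      = Real.exp (ρ * Real.cos θ * t) := by
  rw [Complex.norm_exp, Complex.re_mul_ofReal, re_polar]

theorem norm_arcIntegral_le {φ ψ R K : ℝ} (hφψ : φ ≤ ψ) (hR : 0 < R) {f : ℂ → X}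
    (hf : ∀ θ ∈ Icc φ ψ, ‖f ((R : ℂ) * Complex.exp (Complex.I * θ))‖ ≤ K) :
    ‖arcIntegral φ ψ R f‖ ≤ R * K * (ψ - φ) := by
  have := intervalIntegral.norm_integral_le_of_norm_le_const (a := φ) (b := ψ) (C := R * K)
    (f := fun θ : ℝ => (Complex.I * R * Complex.exp (Complex.I * θ)) •
      f (R * Complex.exp (Complex.I * θ))) fun θ hθ => by
        rw [uIoc_of_le hφψ] at hθ
        rw [norm_smul, mul_assoc, norm_mul, Complex.norm_I, one_mul, norm_polar hR]
        gcongr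
        exact hf θ ⟨hθ.1.le, hθ.2⟩
  rwa [abs_of_nonneg (by linarith)] at this

theorem norm_two_pi_I_inv_le : ‖(2 * Real.pi * Complex.I : ℂ)⁻¹‖ ≤ 1 := by
  have : ‖(2 * Real.pi * Complex.I : ℂ)‖ = 2 * Real.pi := by
    simp [abs_of_pos Real.pi_pos]
  rw [norm_inv, this]
  exact inv_le_one_of_one_le₀ (by linarith [Real.pi_gt_three])

namespace IsSectorSymbol

variable {γ δ M : ℝ} {F : ℂ → X}

theorem nonneg (hF : IsSectorSymbol γ δ M F) (hγ : 0 ≤ γ) : 0 ≤ M := by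
  have := hF.norm_le 1 ⟨one_ne_zero, by simpa using hγ⟩
  simp only [norm_one, Real.one_rpow, mul_one] at this
  exact (norm_nonneg _).trans this

theorem comp_clm (hF : IsSectorSymbol γ δ M F) {Y : Type*} [NormedAddCommGroup Y]
    [NormedSpace ℂ Y] (L : X →L[ℂ] Y) : IsSectorSymbol γ δ (‖L‖ * M) (fun z => L (F z)) where
  differentiableAt z hz := L.differentiableAt.comp z (hF.differentiableAt z hz)
  norm_le z hz := (L.le_opNorm _).trans (by
    rw [mul_assoc]
    exact mul_le_mul_of_nonneg_left (hF.norm_le z hz) (norm_nonneg _))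

theorem differentiableAt_exp_smul (hF : IsSectorSymbol γ δ M F) (t : ℝ) {z : ℂ}
    (hz : z ∈ closedSector γ) : DifferentiableAt ℂ (fun z => Complex.exp (z * t) • F z) z :=
  DifferentiableAt.smul (by fun_prop) (hF.differentiableAt z hz)

theorem continuousOn_ray (hF : IsSectorSymbol γ δ M F) (hγ : γ < Real.pi) {θ : ℝ}
    (hθ : |θ| ≤ γ) : ContinuousOn (fun ρ : ℝ => F (ρ * Complex.exp (Complex.I * θ))) (Ioi 0) := by
  intro ρ hρ
  refine ContinuousAt.continuousWithinAt (ContinuousAt.comp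
    (f := fun ρ : ℝ => (ρ : ℂ) * Complex.exp (Complex.I * θ)) ?_ (by fun_prop))
  exact (hF.differentiableAt _ (polar_mem_closedSector hγ hρ hθ)).continuousAt

theorem continuousOn_arc (hF : IsSectorSymbol γ δ M F) (hγ : γ < Real.pi) {R : ℝ} (hR : 0 < R) :
    ContinuousOn (fun θ : ℝ => F (R * Complex.exp (Complex.I * θ))) (Icc (-γ) γ) := by
  intro θ hθ
  refine ContinuousAt.continuousWithinAt (ContinuousAt.comp
    (f := fun θ : ℝ => (R : ℂ) * Complex.exp (Complex.I * θ)) ?_ (by fun_prop))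
  exact (hF.differentiableAt _ (polar_mem_closedSector hγ hR (abs_le.2 hθ))).continuousAt

theorem norm_ray_le (hF : IsSectorSymbol γ δ M F) (hγ0 : Real.pi / 2 < γ) (hγ : γ < Real.pi)
    {θ : ℝ} (hθ : |θ| = γ) {β : ℝ} (hβ0 : 0 ≤ β) (hβ1 : β ≤ 1) {t ρ : ℝ} (ht : 0 < t)
    (hρ : 0 < ρ) :
    ‖Complex.exp ((ρ : ℂ) * Complex.exp (Complex.I * θ) * t) •
        F (ρ * Complex.exp (Complex.I * θ))‖
      ≤ M * (-Real.cos γ * t) ^ (-β) * ρ ^ (δ - 1 - β) := by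
  have hc : 0 < -Real.cos γ := neg_pos.2 (Real.cos_neg_of_pi_div_two_lt_of_lt hγ0 (by linarith))
  have hM := hF.nonneg (by linarith [Real.pi_pos])
  have hcos : Real.cos θ = Real.cos γ := by rw [← hθ, Real.cos_abs]
  have h1 := hF.norm_le _ (polar_mem_closedSector hγ hρ hθ.le)
  rw [norm_polar hρ] at h1
  have h2 : Real.exp (ρ * Real.cos θ * t) ≤ (-Real.cos γ * t) ^ (-β) * ρ ^ (-β) := by
    rw [← Real.mul_rpow (by positivity) hρ.le]
    refine le_trans (le_of_eq ?_) (exp_neg_le_rpow_neg (by positivity) hβ0 hβ1)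
    rw [hcos]
    ring_nf
  rw [norm_smul, norm_exp_polar_mul, show δ - 1 - β = -β + (δ - 1) by ring, Real.rpow_add hρ]
  calc _ ≤ ((-Real.cos γ * t) ^ (-β) * ρ ^ (-β)) * (M * ρ ^ (δ - 1)) := by gcongr
    _ = _ := by ring

theorem integrableOn_ray (hF : IsSectorSymbol γ δ M F) (hγ0 : Real.pi / 2 < γ)
    (hγ : γ < Real.pi) (hδ : δ < 1) {θ : ℝ} (hθ : |θ| = γ) {t : ℝ} (ht : 0 < t) {R : ℝ}
    (hR : 0 < R) :
    IntegrableOn (fun ρ : ℝ => Complex.exp ((ρ : ℂ) * Complex.exp (Complex.I * θ) * t) •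
        F (ρ * Complex.exp (Complex.I * θ))) (Ioi R) := by
  refine Integrable.mono' ((integrableOn_Ioi_rpow_of_lt (a := δ - 1 - 1) (by linarith)
    hR).const_mul (M * (-Real.cos γ * t) ^ (-1 : ℝ))) ?_ ?_
  · refine ContinuousOn.aestronglyMeasurable ?_ measurableSet_Ioi
    exact ContinuousOn.smul (by fun_prop)
      ((hF.continuousOn_ray hγ hθ.le).mono (Ioi_subset_Ioi hR.le))
  · filter_upwards [self_mem_ae_restrict measurableSet_Ioi] with ρ hρ
    exact hF.norm_ray_le hγ0 hγ hθ zero_le_one le_rfl ht (hR.trans hρ)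

theorem norm_rayIntegral_le (hF : IsSectorSymbol γ δ M F) (hγ0 : Real.pi / 2 < γ)
    (hγ : γ < Real.pi) {θ : ℝ} (hθ : |θ| = γ) {β : ℝ} (hβ0 : 0 ≤ β) (hβ1 : β ≤ 1) (hδβ : δ < β)
    {t R : ℝ} (ht : 0 < t) (hR : 0 < R) :
    ‖rayIntegral θ R (fun z => Complex.exp (z * t) • F z)‖
      ≤ M * (-Real.cos γ * t) ^ (-β) * (R ^ (δ - β) / (β - δ)) := by
  have hi : IntegrableOn (fun ρ : ℝ => M * (-Real.cos γ * t) ^ (-β) * ρ ^ (δ - 1 - β)) (Ioi R) :=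
    (integrableOn_Ioi_rpow_of_lt (by linarith) hR).const_mul _
  have hv : ∫ ρ in Ioi R, M * (-Real.cos γ * t) ^ (-β) * ρ ^ (δ - 1 - β)
      = M * (-Real.cos γ * t) ^ (-β) * (R ^ (δ - β) / (β - δ)) := by
    rw [integral_const_mul, integral_Ioi_rpow_of_lt (by linarith) hR,
      show δ - 1 - β + 1 = δ - β by ring, ← neg_sub δ β, div_neg, neg_div]
  rw [← hv]
  refine norm_integral_le_of_norm_le hi ?_
  filter_upwards [self_mem_ae_restrict measurableSet_Ioi] with ρ hρ
  rw [norm_smul, mul_comm Complex.I, Complex.norm_exp_ofReal_mul_I, one_mul, mul_comm (θ : ℂ)]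
  exact hF.norm_ray_le hγ0 hγ hθ hβ0 hβ1 ht (hR.trans hρ)

theorem contourIntegrable (hF : IsSectorSymbol γ δ M F) (hγ0 : Real.pi / 2 < γ)
    (hγ : γ < Real.pi) (hδ : δ < 1) {t r : ℝ} (ht : 0 < t) (hr : 0 < r) :
    ContourIntegrable γ r (fun z => Complex.exp (z * t) • F z) := by
  have hγ' : 0 < γ := by linarith [Real.pi_pos]
  refine ⟨?_, ?_, hF.integrableOn_ray hγ0 hγ hδ (abs_of_pos hγ') ht hr⟩
  · have := hF.integrableOn_ray hγ0 hγ hδ (θ := -γ) (by rw [abs_neg, abs_of_pos hγ']) ht hr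
    simpa using this
  · refine ContinuousOn.intervalIntegrable ?_
    rw [uIcc_of_le (by linarith)]
    exact ContinuousOn.smul (by fun_prop) (hF.continuousOn_arc hγ hr)

/-- The inner radius of the contour may be chosen at will. -/
theorem hankel_eq_radius [CompleteSpace X] (hF : IsSectorSymbol γ δ M F)
    (hγ0 : Real.pi / 2 < γ) (hγ : γ < Real.pi) (hδ : δ < 1) {t R : ℝ} (ht : 0 < t) (hR : 0 < R) :
    hankel γ F t = (2 * Real.pi * Complex.I : ℂ)⁻¹ •
      contourIntegral γ R (fun z => Complex.exp (z * t) • F z) := by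
  rw [hankel, contourIntegral_radius_eq (by linarith [Real.pi_pos]) hγ
    (fun z hz => hF.differentiableAt_exp_smul t hz)
    (fun r hr θ hθ => hF.integrableOn_ray hγ0 hγ hδ hθ ht hr) (one_div_pos.2 ht) hR]

theorem hankel_comp_clm [CompleteSpace X] (hF : IsSectorSymbol γ δ M F)
    (hγ0 : Real.pi / 2 < γ) (hγ : γ < Real.pi) (hδ : δ < 1) {Y : Type*} [NormedAddCommGroup Y]
    [NormedSpace ℂ Y] [CompleteSpace Y] (L : X →L[ℂ] Y) {t : ℝ} (ht : 0 < t) :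
    hankel γ (fun z => L (F z)) t = L (hankel γ F t) := by
  rw [hankel, hankel, map_smul, ← contourIntegral_comp_clm L
    (hF.contourIntegrable hγ0 hγ hδ ht (one_div_pos.2 ht))]
  simp

theorem hankel_sub [CompleteSpace X] {δ' M' : ℝ} {F' : ℂ → X} (hF : IsSectorSymbol γ δ M F)
    (hF' : IsSectorSymbol γ δ' M' F') (hγ0 : Real.pi / 2 < γ) (hγ : γ < Real.pi) (hδ : δ < 1)
    (hδ' : δ' < 1) {t : ℝ} (ht : 0 < t) :
    hankel γ (fun z => F z - F' z) t = hankel γ F t - hankel γ F' t := by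
  have hγ' : 0 < γ := by linarith [Real.pi_pos]
  have hr : 0 < 1 / t := one_div_pos.2 ht
  have hray : ∀ θ : ℝ, |θ| = γ →
      rayIntegral θ (1 / t) (fun z => Complex.exp (z * t) • (F z - F' z))
        = rayIntegral θ (1 / t) (fun z => Complex.exp (z * t) • F z)
          - rayIntegral θ (1 / t) (fun z => Complex.exp (z * t) • F' z) := by
    intro θ hθ
    have h1 := Integrable.smul (Complex.exp (Complex.I * θ))
      (hF.integrableOn_ray hγ0 hγ hδ hθ ht hr)
    have h2 := Integrable.smul (Complex.exp (Complex.I * θ))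
      (hF'.integrableOn_ray hγ0 hγ hδ' hθ ht hr)
    rw [rayIntegral, rayIntegral, rayIntegral]
    refine Eq.trans ?_ (integral_sub h1 h2)
    simp [smul_sub]
  have harc : arcIntegral (-γ) γ (1 / t) (fun z => Complex.exp (z * t) • (F z - F' z))
      = arcIntegral (-γ) γ (1 / t) (fun z => Complex.exp (z * t) • F z)
        - arcIntegral (-γ) γ (1 / t) (fun z => Complex.exp (z * t) • F' z) := by
    have h1 := (hF.contourIntegrable hγ0 hγ hδ ht hr).2.1.continuousOn_smul
      (f := fun θ : ℝ => Complex.I * (1 / t : ℝ) * Complex.exp (Complex.I * θ)) (by fun_prop)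
    have h2 := (hF'.contourIntegrable hγ0 hγ hδ' ht hr).2.1.continuousOn_smul
      (f := fun θ : ℝ => Complex.I * (1 / t : ℝ) * Complex.exp (Complex.I * θ)) (by fun_prop)
    rw [arcIntegral, arcIntegral, arcIntegral, ← intervalIntegral.integral_sub h1 h2]
    simp [smul_sub]
  rw [hankel, hankel, hankel, contourIntegral_eq_ray_arc, contourIntegral_eq_ray_arc,
    contourIntegral_eq_ray_arc, harc, hray γ (abs_of_pos hγ'),
    hray (-γ) (by rw [abs_neg, abs_of_pos hγ']), ← smul_sub]
  congr 1
  abel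

/-- The symbol `O(|z|^(δ-1))` has an inverse Laplace transform `O(t^(-δ))`: on the contour of
inner radius `1 / t` all of the pieces scale in this way. -/
theorem norm_hankel_le (hF : IsSectorSymbol γ δ M F) (hγ0 : Real.pi / 2 < γ)
    (hγ : γ < Real.pi) (hδ : δ < 1) :
    ∃ C : ℝ, ∀ t : ℝ, 0 < t → ‖hankel γ F t‖ ≤ C * t ^ (-δ) := by
  have hγ' : 0 < γ := by linarith [Real.pi_pos]
  have hM := hF.nonneg hγ'.le
  have hc : 0 < -Real.cos γ := neg_pos.2 (Real.cos_neg_of_pi_div_two_lt_of_lt hγ0 (by linarith))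
  set K := M * (-Real.cos γ)⁻¹ / (1 - δ) with hK
  refine ⟨K + Real.exp 1 * M * (γ - -γ) + K, fun t ht => ?_⟩
  have hr : 0 < 1 / t := one_div_pos.2 ht
  have hpow : ∀ x : ℝ, (1 / t) ^ x = t ^ (-x) := fun x => by
    rw [one_div, Real.inv_rpow ht.le, Real.rpow_neg ht.le]
  have hray : ∀ θ : ℝ, |θ| = γ →
      ‖rayIntegral θ (1 / t) (fun z => Complex.exp (z * t) • F z)‖ ≤ K * t ^ (-δ) := by
    intro θ hθ
    refine (hF.norm_rayIntegral_le hγ0 hγ hθ zero_le_one le_rfl hδ ht hr).trans (le_of_eq ?_)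
    rw [hpow, show -(δ - 1) = -δ + 1 by ring, Real.rpow_add_one ht.ne', Real.rpow_neg_one,
      mul_inv, hK]
    field_simp
  have harc : ‖arcIntegral (-γ) γ (1 / t) (fun z => Complex.exp (z * t) • F z)‖
      ≤ Real.exp 1 * M * (γ - -γ) * t ^ (-δ) := by
    refine (norm_arcIntegral_le (K := Real.exp 1 * (M * (1 / t) ^ (δ - 1))) (by linarith) hr
      fun θ hθ => ?_).trans (le_of_eq ?_)
    · have h1 := hF.norm_le _ (polar_mem_closedSector hγ hr (abs_le.2 hθ))
      rw [norm_polar hr] at h1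
      rw [norm_smul, norm_exp_polar_mul]
      gcongr
      rw [one_div, mul_right_comm, inv_mul_cancel₀ ht.ne', one_mul]
      exact Real.cos_le_one θ
    · rw [hpow, show -(δ - 1) = -δ + 1 by ring, Real.rpow_add_one ht.ne']
      field_simp
  rw [hankel, contourIntegral_eq_ray_arc, norm_smul]
  refine (mul_le_of_le_one_left (norm_nonneg _) norm_two_pi_I_inv_le).trans ?_
  refine (norm_add₃_le).trans ?_
  rw [norm_neg]
  have h1 := hray γ (abs_of_pos hγ')
  have h2 := hray (-γ) (by rw [abs_neg, abs_of_pos hγ'])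
  linarith

theorem aestronglyMeasurable_hankel [CompleteSpace X] (hF : IsSectorSymbol γ δ M F)
    (hγ0 : Real.pi / 2 < γ) (hγ : γ < Real.pi) (hδ : δ < 1) :
    AEStronglyMeasurable (hankel γ F) (volume.restrict (Ioi 0)) := by
  have hγ' : 0 < γ := by linarith [Real.pi_pos]
  have hray : ∀ θ : ℝ, |θ| = γ → AEStronglyMeasurable
      (fun t : ℝ => rayIntegral θ 1 (fun z => Complex.exp (z * t) • F z))
      (volume.restrict (Ioi 0)) := by
    intro θ hθ
    refine AEStronglyMeasurable.integral_prod_right' (f := fun p : ℝ × ℝ =>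
      Complex.exp (Complex.I * θ) • (Complex.exp ((p.2 : ℂ) * Complex.exp (Complex.I * θ) * p.1) •
        F (p.2 * Complex.exp (Complex.I * θ)))) ?_
    refine AEStronglyMeasurable.const_smul (AEStronglyMeasurable.smul ?_ ?_) _
    · exact Continuous.aestronglyMeasurable (by fun_prop)
    · exact AEStronglyMeasurable.comp_snd (f := fun ρ : ℝ => F (ρ * Complex.exp (Complex.I * θ)))
        (((hF.continuousOn_ray hγ hθ.le).mono
          (Ioi_subset_Ioi zero_le_one)).aestronglyMeasurable measurableSet_Ioi)
  have harc : AEStronglyMeasurable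
      (fun t : ℝ => arcIntegral (-γ) γ 1 (fun z => Complex.exp (z * t) • F z))
      (volume.restrict (Ioi 0)) := by
    simp only [arcIntegral, intervalIntegral.integral_of_le (by linarith : -γ ≤ γ)]
    refine AEStronglyMeasurable.integral_prod_right' (f := fun p : ℝ × ℝ =>
      (Complex.I * (1 : ℝ) * Complex.exp (Complex.I * p.2)) •
        (Complex.exp (((1 : ℝ) : ℂ) * Complex.exp (Complex.I * p.2) * p.1) •
        F ((1 : ℝ) * Complex.exp (Complex.I * p.2)))) ?_
    refine AEStronglyMeasurable.smul ?_ (AEStronglyMeasurable.smul ?_ ?_)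
    · exact Continuous.aestronglyMeasurable (by fun_prop)
    · exact Continuous.aestronglyMeasurable (by fun_prop)
    · exact AEStronglyMeasurable.comp_snd
        (f := fun θ : ℝ => F ((1 : ℝ) * Complex.exp (Complex.I * θ)))
        (((hF.continuousOn_arc hγ one_pos).mono Ioc_subset_Icc_self).aestronglyMeasurable
          measurableSet_Ioc)
  have h := ((((hray (-γ) (by rw [abs_neg, abs_of_pos hγ'])).neg.add harc).add
    (hray γ (abs_of_pos hγ'))).const_smul (2 * Real.pi * Complex.I : ℂ)⁻¹)
  refine h.congr ?_
  filter_upwards [self_mem_ae_restrict measurableSet_Ioi] with t ht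
  rw [hF.hankel_eq_radius hγ0 hγ hδ ht one_pos, contourIntegral_eq_ray_arc]
  rfl

end IsSectorSymbol

/-! ### The inverse Laplace transform of `1 / z` -/

theorem eq_zero_of_forall_norm_le_rpow {E : Type*} [NormedAddCommGroup E] {x : E}
    {a b C D R₀ : ℝ} (ha : a < 0) (hb : b < 0)
    (h : ∀ R : ℝ, R₀ ≤ R → 0 < R → ‖x‖ ≤ C * R ^ a + D * R ^ b) : x = 0 := by
  have h1 : ∀ c : ℝ, c < 0 → Filter.Tendsto (fun R : ℝ => R ^ c) Filter.atTop (nhds 0) :=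
    fun c hc => by simpa using tendsto_rpow_neg_atTop (neg_pos.2 hc)
  have hlim := ((h1 a ha).const_mul C).add ((h1 b hb).const_mul D)
  simp only [mul_zero, add_zero] at hlim
  refine norm_le_zero_iff.1 (ge_of_tendsto hlim ?_)
  filter_upwards [Filter.eventually_ge_atTop R₀, Filter.eventually_gt_atTop 0] with R h2 h3
  exact h R h2 h3

theorem closedSector_subset_slitPlane {γ : ℝ} (hγ : γ < Real.pi) {z : ℂ}
    (hz : z ∈ closedSector γ) : z ∈ Complex.slitPlane := by
  refine Complex.mem_slitPlane_iff_arg.2 ⟨fun h => ?_, hz.1⟩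
  have := hz.2
  rw [h, abs_of_pos Real.pi_pos] at this
  linarith

theorem isSectorSymbol_inv (γ : ℝ) : IsSectorSymbol γ 0 1 (fun z : ℂ => z⁻¹) where
  differentiableAt z hz := differentiableAt_inv hz.1
  norm_le z _ := by rw [norm_inv, zero_sub, Real.rpow_neg_one, one_mul]

theorem arcIntegral_exp_inv {R : ℝ} (hR : 0 < R) (φ ψ t : ℝ) :
    arcIntegral φ ψ R (fun z => Complex.exp (z * t) • z⁻¹)
      = ∫ θ in φ..ψ, Complex.I * Complex.exp (R * Complex.exp (Complex.I * θ) * t) := by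
  refine intervalIntegral.integral_congr fun θ _ => ?_
  have hRc : (R : ℂ) ≠ 0 := by exact_mod_cast hR.ne'
  simp only [smul_eq_mul]
  field_simp

theorem arcIntegral_exp_inv_full {R : ℝ} (hR : 0 < R) (φ t : ℝ) :
    arcIntegral φ (φ + 2 * Real.pi) R (fun z => Complex.exp (z * t) • z⁻¹)
      = 2 * Real.pi * Complex.I := by
  have hd : Differentiable ℂ fun z : ℂ => Complex.exp (z * t) := by fun_prop
  have h := (hd.differentiableOn (s := Metric.closedBall 0 R)).circleIntegral_sub_inv_smul
    (Metric.mem_ball_self hR)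
  have hper : Function.Periodic (fun θ : ℝ =>
      Complex.I * Complex.exp (R * Complex.exp (Complex.I * θ) * t)) (2 * Real.pi) := by
    intro θ
    have := Complex.exp_periodic (Complex.I * θ)
    simp only [Complex.ofReal_add, Complex.ofReal_mul, Complex.ofReal_ofNat]
    rw [mul_add, mul_comm Complex.I (2 * (Real.pi : ℂ)), this]
  rw [arcIntegral_exp_inv hR, hper.intervalIntegral_add_eq φ 0, zero_add]
  simp only [zero_mul, Complex.exp_zero, smul_eq_mul, mul_one] at h
  rw [← h, circleIntegral]
  refine intervalIntegral.integral_congr fun θ _ => ?_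
  have hRc : (R : ℂ) ≠ 0 := by exact_mod_cast hR.ne'
  simp only [deriv_circleMap, circleMap, zero_add, sub_zero, smul_eq_mul,
    mul_comm Complex.I (θ : ℂ)]
  field_simp

/-- The inverse Laplace transform of `1 / z` is `1`. The contour is closed to the left by the arc
from angle `γ` to `2π - γ`, on which `e^(zt)` decays. -/
theorem hankel_inv {γ : ℝ} (hγ0 : Real.pi / 2 < γ) (hγ : γ < Real.pi) {t : ℝ} (ht : 0 < t) :
    hankel γ (fun z : ℂ => z⁻¹) t = 1 := by
  have hπ := Real.pi_pos
  have hγ' : 0 < γ := by linarith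
  have hr : 0 < 1 / t := one_div_pos.2 ht
  set κ := -Real.cos γ with hκ
  have hc : 0 < κ := neg_pos.2 (Real.cos_neg_of_pi_div_two_lt_of_lt hγ0 (by linarith))
  have hS := isSectorSymbol_inv γ
  set f : ℂ → ℂ := fun z => Complex.exp (z * t) • z⁻¹ with hf
  have hmain : contourIntegral γ (1 / t) f - 2 * Real.pi * Complex.I = 0 := by
    refine eq_zero_of_forall_norm_le_rpow (a := -1) (b := -1) (R₀ := 1 / t)
      (C := (κ * t)⁻¹ + (κ * t)⁻¹) (D := (κ * t)⁻¹ * (2 * Real.pi - γ - γ))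
      (by norm_num) (by norm_num) fun R hrR hR => ?_
    have hcauchy := annular_sector_cauchy (f := f) (φ := γ) (ψ := 2 * Real.pi - γ) hr hrR
      (by linarith) fun ρ hρ θ _ => by
        have h0 := polar_ne_zero (hr.trans_le hρ.1) θ
        have h1 : DifferentiableAt ℂ (fun z : ℂ => Complex.exp (z * t))
            (ρ * Complex.exp (Complex.I * θ)) := by fun_prop
        exact h1.smul (differentiableAt_inv h0)
    have hperiod : Complex.exp (Complex.I * (2 * Real.pi - γ : ℝ))
        = Complex.exp (Complex.I * (-γ : ℝ)) := by
      have := Complex.exp_periodic (Complex.I * (-γ : ℝ))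
      rw [← this]
      push_cast
      ring_nf
    rw [hperiod] at hcauchy
    have hadd : arcIntegral (-γ) γ (1 / t) f + arcIntegral γ (2 * Real.pi - γ) (1 / t) f
        = 2 * Real.pi * Complex.I := by
      rw [← arcIntegral_exp_inv_full hr (-γ) t, show -γ + 2 * Real.pi = 2 * Real.pi - γ by ring,
        hf, arcIntegral_exp_inv hr, arcIntegral_exp_inv hr, arcIntegral_exp_inv hr]
      exact intervalIntegral.integral_add_adjacent_intervals
        (Continuous.intervalIntegrable (by fun_prop) _ _)
        (Continuous.intervalIntegrable (by fun_prop) _ _)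
    have hpos : |γ| = γ := abs_of_pos hγ'
    have hneg : |-γ| = γ := by rw [abs_neg, hpos]
    have hEq : contourIntegral γ (1 / t) f - 2 * Real.pi * Complex.I
        = -rayIntegral (-γ) R f + rayIntegral γ R f - arcIntegral γ (2 * Real.pi - γ) R f := by
      rw [contourIntegral_eq_ray_arc,
        rayIntegral_eq_add hrR (hS.integrableOn_ray hγ0 hγ zero_lt_one hneg ht hr),
        rayIntegral_eq_add hrR (hS.integrableOn_ray hγ0 hγ zero_lt_one hpos ht hr)]
      linear_combination hcauchy + hadd
    have hray : ∀ θ : ℝ, |θ| = γ → ‖rayIntegral θ R f‖ ≤ (κ * t)⁻¹ * R ^ (-1 : ℝ) := by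
      intro θ hθ
      refine (hS.norm_rayIntegral_le hγ0 hγ hθ zero_le_one le_rfl zero_lt_one ht hR).trans
        (le_of_eq ?_)
      rw [Real.rpow_neg_one, one_mul, zero_sub, sub_zero, div_one]
    have harc : ‖arcIntegral γ (2 * Real.pi - γ) R f‖
        ≤ (κ * t)⁻¹ * (2 * Real.pi - γ - γ) * R ^ (-1 : ℝ) := by
      refine (norm_arcIntegral_le (K := (κ * t * R)⁻¹ * R⁻¹) (by linarith) hR
        fun θ hθ => ?_).trans (le_of_eq ?_)
      · have hcos : Real.cos θ ≤ Real.cos γ := by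
          rcases le_total θ Real.pi with h | h
          · exact Real.cos_le_cos_of_nonneg_of_le_pi hγ'.le h hθ.1
          · rw [← Real.cos_two_pi_sub θ]
            exact Real.cos_le_cos_of_nonneg_of_le_pi hγ'.le (by linarith) (by linarith [hθ.2])
        rw [hf, norm_smul, norm_exp_polar_mul, norm_inv, norm_polar hR]
        gcongr
        refine le_trans (Real.exp_le_exp.2 (?_ : _ ≤ -(κ * t * R)))
          ((exp_neg_le_rpow_neg (by positivity) zero_le_one le_rfl).trans
            (Real.rpow_neg_one _).le)
        have := mul_le_mul_of_nonneg_left hcos (mul_pos hR ht).le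
        rw [hκ]
        linarith
      · rw [Real.rpow_neg_one]
        field_simp
    rw [hEq]
    refine (norm_sub_le _ _).trans (add_le_add ((norm_add_le _ _).trans ?_) harc)
    rw [norm_neg, add_mul]
    exact add_le_add (hray _ hneg) (hray _ hpos)
  rw [hankel, sub_eq_zero.1 hmain, smul_eq_mul, inv_mul_cancel₀]
  exact Complex.two_pi_I_ne_zero

/-! ### Fractional integrals of inverse Laplace transforms -/

namespace IsSectorSymbol

variable {γ δ M : ℝ} {F : ℂ → X}

theorem cpow_smul (hF : IsSectorSymbol γ δ M F) (hγ : γ < Real.pi) (α : ℝ) :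
    IsSectorSymbol γ (δ - α) M (fun z => z ^ (-α : ℂ) • F z) where
  differentiableAt z hz := DifferentiableAt.smul
    (differentiableAt_id.cpow_const (closedSector_subset_slitPlane hγ hz))
    (hF.differentiableAt z hz)
  norm_le z hz := by
    have hz0 : 0 < ‖z‖ := norm_pos_iff.2 hz.1
    rw [norm_smul, ← Complex.ofReal_neg, Complex.norm_cpow_real,
      show δ - α - 1 = -α + (δ - 1) by ring, Real.rpow_add hz0, mul_left_comm]
    exact mul_le_mul_of_nonneg_left (hF.norm_le z hz) (by positivity)

/-- The inverse Laplace transform is the integral over the arc of radius `R`, up to an error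
which decays as `R → ∞`. -/
theorem norm_hankel_sub_arc_le [CompleteSpace X] (hF : IsSectorSymbol γ δ M F)
    (hγ0 : Real.pi / 2 < γ) (hγ : γ < Real.pi) {β : ℝ} (hβ0 : 0 ≤ β) (hβ1 : β < 1)
    (hδβ : δ < β) {t R : ℝ} (ht : 0 < t) (hR : 0 < R) :
    ‖hankel γ F t - (2 * Real.pi * Complex.I : ℂ)⁻¹ •
        arcIntegral (-γ) γ R (fun z => Complex.exp (z * t) • F z)‖
      ≤ 2 * M * (-Real.cos γ) ^ (-β) / (β - δ) * R ^ (δ - β) * t ^ (-β) := by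
  have hγ' : 0 < γ := by linarith [Real.pi_pos]
  have hc : 0 < -Real.cos γ := neg_pos.2 (Real.cos_neg_of_pi_div_two_lt_of_lt hγ0 (by linarith))
  have h1 := hF.norm_rayIntegral_le hγ0 hγ (abs_of_pos hγ') hβ0 hβ1.le hδβ ht hR
  have h2 := hF.norm_rayIntegral_le hγ0 hγ (θ := -γ) (by rw [abs_neg, abs_of_pos hγ']) hβ0 hβ1.le
    hδβ ht hR
  rw [hF.hankel_eq_radius hγ0 hγ (hδβ.trans hβ1) ht hR, contourIntegral_eq_ray_arc, ← smul_sub,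
    norm_smul]
  refine (mul_le_of_le_one_left (norm_nonneg _) norm_two_pi_I_inv_le).trans ?_
  rw [show ∀ a b c : X, -a + b + c - b = c - a from fun a b c => by abel]
  refine (norm_sub_le _ _).trans ((add_le_add h1 h2).trans (le_of_eq ?_))
  rw [Real.mul_rpow hc.le ht.le]
  ring

/-- Fubini's theorem on `(0,t)` times an arc. -/
theorem fracIntegral_arc_swap [CompleteSpace X] (hF : IsSectorSymbol γ δ M F) (hγ0 : 0 < γ)
    (hγ : γ < Real.pi) {α : ℝ} (hα : 0 < α) {t R : ℝ} (ht : 0 < t) (hR : 0 < R) :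
    IntervalIntegrable (fun s : ℝ => ((t - s) ^ (α - 1) : ℝ) •
      arcIntegral (-γ) γ R (fun z => Complex.exp (z * s) • F z)) volume 0 t ∧
    IntervalIntegrable (fun θ : ℝ => (Complex.I * R * Complex.exp (Complex.I * θ)) •
      (∫ s in (0 : ℝ)..t, (((t - s) ^ (α - 1) : ℝ) : ℂ) *
        Complex.exp (R * Complex.exp (Complex.I * θ) * s)) •
          F (R * Complex.exp (Complex.I * θ))) volume (-γ) γ ∧
    ∫ s in (0 : ℝ)..t, ((t - s) ^ (α - 1) : ℝ) •
      arcIntegral (-γ) γ R (fun z => Complex.exp (z * s) • F z)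
      = arcIntegral (-γ) γ R (fun z => (∫ s in (0 : ℝ)..t, (((t - s) ^ (α - 1) : ℝ) : ℂ) *
          Complex.exp (z * s)) • F z) := by
  have hγn : -γ ≤ γ := by linarith
  set H : ℝ × ℝ → X := fun p => (Complex.I * R * Complex.exp (Complex.I * p.2) *
      Complex.exp (R * Complex.exp (Complex.I * p.2) * p.1)) •
    ((((t - p.1) ^ (α - 1) : ℝ) : ℂ) • F (R * Complex.exp (Complex.I * p.2))) with hH
  have hk : Integrable (fun s : ℝ => (((t - s) ^ (α - 1) : ℝ) : ℂ))
      (volume.restrict (Ioc 0 t)) :=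
    ((intervalIntegrable_iff_integrableOn_Ioc_of_le ht.le).1
      (intervalIntegrable_sub_rpow hα t)).ofReal
  have hFi : Integrable (fun θ : ℝ => F (R * Complex.exp (Complex.I * θ)))
      (volume.restrict (Ioc (-γ) γ)) := by
    refine ((ContinuousOn.integrableOn_compact isCompact_Icc ?_).mono_set Ioc_subset_Icc_self)
    exact hF.continuousOn_arc hγ hR
  have hHi : Integrable H ((volume.restrict (Ioc 0 t)).prod (volume.restrict (Ioc (-γ) γ))) := by
    refine Integrable.bdd_smul (hk.smul_prod hFi) (R * Real.exp (R * t)) ?_ ?_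
    · exact Continuous.aestronglyMeasurable (by fun_prop)
    · rw [Measure.prod_restrict]
      refine (ae_restrict_iff' (measurableSet_Ioc.prod measurableSet_Ioc)).2
        (Filter.Eventually.of_forall fun p hp => ?_)
      rw [norm_mul, mul_assoc, norm_mul, Complex.norm_I, one_mul, norm_polar hR,
        norm_exp_polar_mul]
      gcongr
      · exact hp.1.1.le
      · exact mul_le_of_le_one_right hR.le (Real.cos_le_one _)
      · exact hp.1.2
  have hs : ∀ s : ℝ, ((t - s) ^ (α - 1) : ℝ) •
      arcIntegral (-γ) γ R (fun z => Complex.exp (z * s) • F z)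
      = ∫ θ in Ioc (-γ) γ, H (s, θ) := by
    intro s
    rw [arcIntegral, ← intervalIntegral.integral_smul, intervalIntegral.integral_of_le hγn]
    refine integral_congr_ae (Filter.Eventually.of_forall fun θ => ?_)
    simp only [hH]
    rw [← Complex.coe_smul, smul_smul, smul_smul, smul_smul]
    ring_nf
  have hθ : ∀ θ : ℝ, (Complex.I * R * Complex.exp (Complex.I * θ)) •
      (∫ s in (0 : ℝ)..t, (((t - s) ^ (α - 1) : ℝ) : ℂ) *
        Complex.exp (R * Complex.exp (Complex.I * θ) * s)) •
          F (R * Complex.exp (Complex.I * θ)) = ∫ s in Ioc 0 t, H (s, θ) := by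
    intro θ
    rw [← intervalIntegral.integral_smul_const, ← intervalIntegral.integral_smul,
      intervalIntegral.integral_of_le ht.le]
    refine integral_congr_ae (Filter.Eventually.of_forall fun s => ?_)
    simp only [hH]
    rw [smul_smul, smul_smul]
    ring_nf
  refine ⟨?_, ?_, ?_⟩
  · rw [intervalIntegrable_iff_integrableOn_Ioc_of_le ht.le]
    simp only [hs]
    exact hHi.integral_prod_left
  · rw [intervalIntegrable_iff_integrableOn_Ioc_of_le hγn]
    simp only [hθ]
    exact hHi.integral_prod_right
  · rw [arcIntegral, intervalIntegral.integral_of_le ht.le, intervalIntegral.integral_of_le hγn]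
    simp only [hs, hθ]
    exact integral_integral_swap hHi

/-- The fractional integral of order `α` multiplies the Laplace transform by `z^(-α)`. Both sides
are replaced by integrals over an arc of large radius `R`, where Fubini's theorem applies, and
the arcs differ by an integral which tends to zero as `R → ∞`. -/
theorem fracIntegral_hankel [CompleteSpace X] (hF : IsSectorSymbol γ δ M F)
    (hγ0 : Real.pi / 2 < γ) (hγ : γ < Real.pi) (hδ : δ < 1) {α : ℝ} (hα0 : 0 < α) (hα1 : α < 1)
    {t : ℝ} (ht : 0 < t) :
    fracIntegral α (hankel γ F) t = hankel γ (fun z => z ^ (-α : ℂ) • F z) t := by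
  have hγ' : 0 < γ := by linarith [Real.pi_pos]
  have hγn : -γ ≤ γ := by linarith
  have hM := hF.nonneg hγ'.le
  have hc : 0 < -Real.cos γ := neg_pos.2 (Real.cos_neg_of_pi_div_two_lt_of_lt hγ0 (by linarith))
  -- an exponent `β` with `max δ α < β < 1` makes all error terms converge
  obtain ⟨β, hβl, hβ1⟩ := exists_between (max_lt hδ hα1)
  have hδβ : δ < β := (le_max_left _ _).trans_lt hβl
  have hαβ : α < β := (le_max_right _ _).trans_lt hβl
  have hβ0 : 0 < β := hα0.trans hαβ
  have hF' := hF.cpow_smul hγ α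
  have hΓ : 0 < Real.Gamma α := Real.Gamma_pos_of_pos hα0
  set g := (Real.Gamma α)⁻¹ with hg
  have hg0 : 0 < g := inv_pos.2 hΓ
  set c : ℂ := (2 * Real.pi * Complex.I : ℂ)⁻¹ with hcdef
  obtain ⟨D, hD0, hD⟩ := norm_fracIntegral_exp_sub_le hα0 hα1 hαβ hβ1 ht
  have hcosi := intervalIntegrable_abs_cos_rpow hβ0 hβ1 hγ'.le hγ.le
  have hbeta := intervalIntegrable_sub_rpow_mul_rpow hα0 hβ1 ht
  set W := ∫ θ in (-γ)..γ, |Real.cos θ| ^ (-β) with hW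
  set B := ∫ s in (0 : ℝ)..t, (t - s) ^ (α - 1) * s ^ (-β) with hB
  set K := 2 * M * (-Real.cos γ) ^ (-β) / (β - δ) with hK
  set K' := 2 * M * (-Real.cos γ) ^ (-β) / (β - (δ - α)) * t ^ (-β) with hK'
  have hkh : IntervalIntegrable (fun s : ℝ => ((t - s) ^ (α - 1) : ℝ) • hankel γ F s)
      volume 0 t := by
    obtain ⟨C, hC⟩ := hF.norm_hankel_le hγ0 hγ hδ
    have hi := ((intervalIntegrable_iff_integrableOn_Ioc_of_le ht.le).1
      (intervalIntegrable_sub_rpow_mul_rpow hα0 hδ ht)).const_mul C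
    rw [intervalIntegrable_iff_integrableOn_Ioc_of_le ht.le]
    refine Integrable.mono' hi ?_ ?_
    · have : Measurable fun s : ℝ => (t - s) ^ (α - 1) := by fun_prop
      exact this.aestronglyMeasurable.smul ((hF.aestronglyMeasurable_hankel hγ0 hγ hδ).mono_measure
        (Measure.restrict_mono Ioc_subset_Ioi_self le_rfl))
    · filter_upwards [self_mem_ae_restrict measurableSet_Ioc] with s hs
      have hts : 0 ≤ t - s := by linarith [hs.2]
      rw [norm_smul, Real.norm_of_nonneg (by positivity), mul_left_comm]
      exact mul_le_mul_of_nonneg_left (hC s hs.1) (by positivity)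
  rw [← sub_eq_zero]
  refine eq_zero_of_forall_norm_le_rpow (a := δ - β) (b := δ - α - β) (R₀ := 0)
    (C := g * (K * B) + D * M * W) (D := K') (by linarith) (by linarith) fun R _ hR => ?_
  obtain ⟨hi1, hi2, hswap⟩ := hF.fracIntegral_arc_swap hγ' hγ hα0 ht hR
  set Arc := arcIntegral (-γ) γ R (fun z => (∫ s in (0 : ℝ)..t,
    (((t - s) ^ (α - 1) : ℝ) : ℂ) * Complex.exp (z * s)) • F z) with hArc
  set Arc' := arcIntegral (-γ) γ R (fun z => Complex.exp (z * t) • (z ^ (-α : ℂ) • F z)) with hArc'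
  have e1 : ‖fracIntegral α (hankel γ F) t - g • c • Arc‖ ≤ g * (K * B) * R ^ (δ - β) := by
    have hi1' : IntervalIntegrable (fun s : ℝ => ((t - s) ^ (α - 1) : ℝ) • c •
        arcIntegral (-γ) γ R (fun z => Complex.exp (z * s) • F z)) volume 0 t := by
      refine (hi1.smul c).congr fun s _ => ?_
      exact smul_comm _ _ _
    have hcArc : c • Arc = ∫ s in (0 : ℝ)..t, ((t - s) ^ (α - 1) : ℝ) • c •
        arcIntegral (-γ) γ R (fun z => Complex.exp (z * s) • F z) := by
      rw [← hswap, ← intervalIntegral.integral_smul]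
      refine intervalIntegral.integral_congr fun s _ => ?_
      exact smul_comm _ _ _
    rw [fracIntegral, ← smul_sub, hcArc, ← intervalIntegral.integral_sub hkh hi1', norm_smul,
      Real.norm_of_nonneg hg0.le, mul_assoc]
    refine mul_le_mul_of_nonneg_left ?_ hg0.le
    rw [mul_right_comm, hB, ← intervalIntegral.integral_const_mul]
    refine intervalIntegral.norm_integral_le_of_norm_le ht.le (Filter.Eventually.of_forall ?_)
      (hbeta.const_mul _)
    intro s hs
    have hts : 0 ≤ t - s := by linarith [hs.2]
    rw [← smul_sub, norm_smul, Real.norm_of_nonneg (by positivity), mul_left_comm]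
    exact mul_le_mul_of_nonneg_left
      (hF.norm_hankel_sub_arc_le hγ0 hγ hβ0.le hβ1 hδβ hs.1 hR) (by positivity)
  have e2 := hF'.norm_hankel_sub_arc_le hγ0 hγ hβ0.le hβ1 (by linarith) ht hR
  have e3 : ‖(g : ℂ) • Arc - Arc'‖ ≤ D * M * W * R ^ (δ - β) := by
    have hi2' : IntervalIntegrable (fun θ : ℝ => (g : ℂ) •
        (Complex.I * R * Complex.exp (Complex.I * θ)) •
        (∫ s in (0 : ℝ)..t, (((t - s) ^ (α - 1) : ℝ) : ℂ) *
          Complex.exp (R * Complex.exp (Complex.I * θ) * s)) •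
            F (R * Complex.exp (Complex.I * θ))) volume (-γ) γ := hi2.smul (g : ℂ)
    have hi3 : IntervalIntegrable (fun θ : ℝ => (Complex.I * R * Complex.exp (Complex.I * θ)) •
        (Complex.exp (R * Complex.exp (Complex.I * θ) * t) •
          ((R * Complex.exp (Complex.I * θ)) ^ (-α : ℂ) • F (R * Complex.exp (Complex.I * θ)))))
        volume (-γ) γ := by
      refine ContinuousOn.intervalIntegrable ?_
      rw [uIcc_of_le hγn]
      exact ContinuousOn.smul (by fun_prop)
        (ContinuousOn.smul (by fun_prop) (hF'.continuousOn_arc hγ hR))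
    rw [hArc, hArc', arcIntegral, arcIntegral, ← intervalIntegral.integral_smul,
      ← intervalIntegral.integral_sub hi2' hi3]
    have hval : D * M * W * R ^ (δ - β)
        = ∫ θ in (-γ)..γ, (D * M * R ^ (δ - β)) * |Real.cos θ| ^ (-β) := by
      rw [intervalIntegral.integral_const_mul, ← hW]
      ring
    rw [hval]
    refine intervalIntegral.norm_integral_le_of_norm_le hγn ?_ (hcosi.const_mul _)
    have hne : ∀ᵐ θ : ℝ, Real.cos θ ≠ 0 := by
      have hcount : {θ : ℝ | Real.cos θ = 0}.Countable := by
        have : {θ : ℝ | Real.cos θ = 0} ⊆ range fun k : ℤ => (2 * k + 1) * Real.pi / 2 := by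
          intro θ hθ
          obtain ⟨k, hk⟩ := Real.cos_eq_zero_iff.1 hθ
          exact ⟨k, hk.symm⟩
        exact (countable_range _).mono this
      exact hcount.ae_notMem volume
    filter_upwards [hne] with θ hθ0 hθ
    have hre : ((R : ℂ) * Complex.exp (Complex.I * θ)).re ≠ 0 := by
      rw [re_polar]
      exact mul_ne_zero hR.ne' hθ0
    have h1 := hD _ hre
    rw [re_polar, abs_mul, abs_of_pos hR, Real.mul_rpow hR.le (abs_nonneg _)] at h1
    have h2 := hF.norm_le _ (polar_mem_closedSector hγ hR (abs_le.2 ⟨hθ.1.le, hθ.2⟩))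
    rw [norm_polar hR] at h2
    have h3 : ‖Complex.I * R * Complex.exp (Complex.I * θ)‖ = R := by
      rw [mul_assoc, norm_mul, Complex.norm_I, one_mul, norm_polar hR]
    have h4 : ∀ (a b d e : ℂ) (x : X), (g : ℂ) • a • b • x - a • d • e • x
        = a • ((g * b - d * e) • x) := fun a b d e x => by module
    rw [h4, norm_smul, norm_smul, h3]
    have h5 : D * M * R ^ (δ - β) * |Real.cos θ| ^ (-β)
        = R * ((D * (R ^ (-β) * |Real.cos θ| ^ (-β))) * (M * R ^ (δ - 1))) := by
      have : R ^ (δ - β) = R * R ^ (-β) * R ^ (δ - 1) := by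
        rw [← Real.rpow_one_add' hR.le (by linarith), ← Real.rpow_add hR]
        ring_nf
      rw [this]
      ring
    rw [h5]
    gcongr
  have hcs : g • c • Arc = c • ((g : ℂ) • Arc) := by
    rw [← Complex.coe_smul, smul_comm]
  have hsum : fracIntegral α (hankel γ F) t - hankel γ (fun z => z ^ (-α : ℂ) • F z) t
      = (fracIntegral α (hankel γ F) t - g • c • Arc) + c • ((g : ℂ) • Arc - Arc')
        - (hankel γ (fun z => z ^ (-α : ℂ) • F z) t - c • Arc') := by
    rw [hcs, smul_sub]
    abel
  rw [hsum]
  refine (norm_sub_le _ _).trans (add_le_add ((norm_add_le _ _).trans ?_) ?_)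
  · rw [add_mul]
    refine add_le_add e1 ?_
    rw [norm_smul]
    exact (mul_le_of_le_one_left (norm_nonneg _) norm_two_pi_I_inv_le).trans e3
  · refine e2.trans (le_of_eq ?_)
    rw [hK']
    ring

end IsSectorSymbol

/-! ### The solution operator -/

/-- The Laplace transform `z^(α-1) (z^α - A)⁻¹ a` of `G(t) a`. -/
def solSymbol (A : X →ₗ.[ℂ] X) (α : ℝ) (a : X) (z : ℂ) : X :=
  z ^ ((α : ℂ) - 1) • resolventOp A (z ^ (α : ℂ)) a

/-- The Laplace transform `z^(α-1) A (z^α - A)⁻¹ a` of `A G(t) a`, with `A (w - A)⁻¹ a` written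
as `w (w - A)⁻¹ a - a`. -/
def genSymbol (A : X →ₗ.[ℂ] X) (α : ℝ) (a : X) (z : ℂ) : X :=
  z ^ ((α : ℂ) - 1) • (z ^ (α : ℂ) • resolventOp A (z ^ (α : ℂ)) a - a)

theorem cpow_mem_sector {α γ γ' : ℝ} (hα0 : 0 < α) (hα1 : α < 1) (hγ : γ < Real.pi)
    (hγ' : α * γ < γ') {z : ℂ} (hz : z ∈ closedSector γ) : z ^ (α : ℂ) ∈ sector γ' := by
  have hb := abs_le.1 hz.2
  have harg : (z ^ (α : ℂ)).arg = α * z.arg := by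
    have him : (Complex.log z * (α : ℂ)).im = α * z.arg := by
      rw [mul_comm, Complex.im_ofReal_mul, Complex.log_im]
    have habs : |α * z.arg| < Real.pi := by
      rw [abs_mul, abs_of_pos hα0]
      have := mul_le_of_le_one_left (abs_nonneg z.arg) hα1.le
      linarith [hz.2]
    rw [Complex.cpow_def_of_ne_zero hz.1, ← Complex.log_im, Complex.log_exp, him]
    · rw [him]; exact (abs_lt.1 habs).1
    · rw [him]; exact (abs_lt.1 habs).2.le
  refine ⟨fun h => hz.1 ((Complex.cpow_eq_zero_iff _ _).1 h).1, ?_⟩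
  rw [harg, abs_mul, abs_of_pos hα0]
  exact (mul_le_mul_of_nonneg_left hz.2 hα0.le).trans_lt hγ'

theorem norm_cpow_sub_one (z : ℂ) (α : ℝ) : ‖z ^ ((α : ℂ) - 1)‖ = ‖z‖ ^ (α - 1) := by
  rw [← Complex.norm_cpow_real]
  push_cast
  rfl

theorem contourIntegral_congr {γ r : ℝ} (hγ0 : 0 < γ) (hγ : γ < Real.pi) (hr : 0 < r)
    {f g : ℂ → X} (h : ∀ z ∈ closedSector γ, f z = g z) :
    contourIntegral γ r f = contourIntegral γ r g := by
  have hray : ∀ θ : ℝ, |θ| ≤ γ → rayIntegral θ r f = rayIntegral θ r g := fun θ hθ =>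
    setIntegral_congr_fun measurableSet_Ioi fun ρ hρ => by
      simp only [h _ (polar_mem_closedSector hγ (hr.trans hρ) hθ)]
  have harc : arcIntegral (-γ) γ r f = arcIntegral (-γ) γ r g :=
    intervalIntegral.integral_congr fun θ hθ => by
      rw [uIcc_of_le (by linarith)] at hθ
      simp only [h _ (polar_mem_closedSector hγ hr (abs_le.2 hθ))]
  rw [contourIntegral_eq_ray_arc, contourIntegral_eq_ray_arc, harc, hray γ (abs_of_pos hγ0).le,
    hray (-γ) (by rw [abs_neg, abs_of_pos hγ0])]

theorem hankel_congr {γ t : ℝ} (hγ0 : 0 < γ) (hγ : γ < Real.pi) (ht : 0 < t) {F F' : ℂ → X}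
    (h : ∀ z ∈ closedSector γ, F z = F' z) : hankel γ F t = hankel γ F' t := by
  rw [hankel, hankel, contourIntegral_congr hγ0 hγ (one_div_pos.2 ht)]
  intro z hz
  rw [h z hz]

theorem hankel_inv_smul [CompleteSpace X] {γ : ℝ} (hγ0 : Real.pi / 2 < γ) (hγ : γ < Real.pi)
    {t : ℝ} (ht : 0 < t) (a : X) : hankel γ (fun z : ℂ => z⁻¹ • a) t = a := by
  have h := (isSectorSymbol_inv γ).hankel_comp_clm hγ0 hγ zero_lt_one
    (ContinuousLinearMap.toSpanSingleton ℂ a) ht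
  rw [hankel_inv hγ0 hγ ht] at h
  simpa using h

theorem isSectorSymbol_inv_smul (γ : ℝ) (a : X) :
    IsSectorSymbol γ 0 (‖ContinuousLinearMap.toSpanSingleton ℂ a‖ * 1)
      (fun z : ℂ => z⁻¹ • a) :=
  (isSectorSymbol_inv γ).comp_clm (ContinuousLinearMap.toSpanSingleton ℂ a)

theorem solOp_eq_hankel (A : X →ₗ.[ℂ] X) (γ α : ℝ) {t : ℝ} (ht : 0 < t) (a : X) :
    solOp A γ α t a = hankel γ (solSymbol A α a) t := by
  rw [solOp, hankel, Complex.norm_real, Real.norm_of_nonneg ht.le]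
  congr 2
  ext z
  rw [solIntegrand, solSymbol, mul_smul]

theorem cpow_neg_smul_genSymbol (A : X →ₗ.[ℂ] X) (α : ℝ) (a : X) {z : ℂ} (hz : z ≠ 0) :
    z ^ (-α : ℂ) • genSymbol A α a z = solSymbol A α a z - z⁻¹ • a := by
  have h1 : z ^ (-α : ℂ) * z ^ ((α : ℂ) - 1) = z⁻¹ := by
    rw [← Complex.cpow_add _ _ hz, ← Complex.cpow_neg_one]
    ring_nf
  have h2 : z⁻¹ * z ^ (α : ℂ) = z ^ ((α : ℂ) - 1) := by
    rw [Complex.cpow_sub _ _ hz, Complex.cpow_one, div_eq_inv_mul]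
  rw [genSymbol, solSymbol, smul_smul, h1, smul_sub, smul_smul, h2]

namespace SectorialCondition

variable {A : X →ₗ.[ℂ] X} {γ α : ℝ}

theorem differentiableAt_resolventOp_cpow (hA : SectorialCondition A γ) (hα0 : 0 < α)
    (hα1 : α < 1) (a : X) {z : ℂ} (hz : z ∈ closedSector γ) :
    DifferentiableAt ℂ (fun z : ℂ => resolventOp A (z ^ (α : ℂ)) a) z := by
  have hγ : 0 < γ := by linarith [hA.angle_gt, Real.pi_pos]
  have h1 : DifferentiableAt ℂ (fun z : ℂ => z ^ (α : ℂ)) z :=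
    differentiableAt_id.cpow_const (closedSector_subset_slitPlane hA.angle_lt hz)
  have h2 := hA.differentiableAt_resolventOp
    (cpow_mem_sector hα0 hα1 hA.angle_lt (mul_lt_of_lt_one_left hγ hα1) hz)
  exact (DifferentiableAt.comp z h2 h1).clm_apply (differentiableAt_const a)

theorem isSectorSymbol_solSymbol (hA : SectorialCondition A γ) (hα0 : 0 < α) (hα1 : α < 1)
    (a : X) : ∃ M : ℝ, IsSectorSymbol γ 0 M (solSymbol A α a) := by
  have hγ : 0 < γ := by linarith [hA.angle_gt, Real.pi_pos]
  obtain ⟨ε, hε0, hε⟩ := exists_between (sub_pos.2 (mul_lt_of_lt_one_left hγ hα1))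
  obtain ⟨C, hC, hb⟩ := hA.bound ε hε0 (hε.trans (sub_lt_self _ (by positivity)))
  refine ⟨C * ‖a‖, fun z hz => ?_, fun z hz => ?_⟩
  · exact (differentiableAt_id.cpow_const (closedSector_subset_slitPlane hA.angle_lt hz)).smul
      (hA.differentiableAt_resolventOp_cpow hα0 hα1 a hz)
  · have hz0 : 0 < ‖z‖ := norm_pos_iff.2 hz.1
    have h1 := hb _ (cpow_mem_sector hα0 hα1 hA.angle_lt (by linarith) hz)
    rw [Complex.norm_cpow_real] at h1
    rw [solSymbol, norm_smul, norm_cpow_sub_one]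
    calc ‖z‖ ^ (α - 1) * ‖resolventOp A (z ^ (α : ℂ)) a‖
        ≤ ‖z‖ ^ (α - 1) * (C / ‖z‖ ^ α * ‖a‖) := by
          gcongr
          exact (ContinuousLinearMap.le_opNorm _ _).trans (by gcongr)
      _ = C * ‖a‖ * ‖z‖ ^ ((0 : ℝ) - 1) := by
          rw [Real.rpow_sub_one hz0.ne', zero_sub, Real.rpow_neg_one]
          have := (Real.rpow_pos_of_pos hz0 α).ne'
          field_simp

/-- For `a ∈ D((-A)^μ)`, `‖A (z - A)⁻¹ a‖ = O(|z|^(-ν))` with `ν = max(μ, 0)`. -/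
theorem norm_generator_resolvent_le [CompleteSpace X] (hA : SectorialCondition A γ) {ε : ℝ}
    (hε0 : 0 < ε) (hεγ : ε < γ) {μ : ℝ} (hμ1 : μ < 1) {a : X} (ha : a ∈ (fracPow A μ).domain) :
    ∃ C : ℝ, ∀ z ∈ sector (γ - ε), ‖z • resolventOp A z a - a‖ ≤ C * ‖z‖ ^ (-max μ 0) := by
  rcases lt_or_ge 0 μ with hμ0 | hμ0
  · rw [max_eq_left hμ0.le]
    rw [fracPow, if_pos hμ0, LinearPMap.inverse_domain] at ha
    obtain ⟨b, rfl⟩ := ha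
    have hfr : Int.fract μ = μ := Int.fract_eq_self.2 ⟨hμ0.le, hμ1⟩
    have hb : (((negPow A μ : X →ₗ[ℂ] X).toPMap ⊤).toFun b : X) = balakrishnan A μ (b : X) := by
      change negPow A μ (b : X) = _
      rw [negPow, hfr, if_neg hμ0.ne', Nat.floor_eq_zero.2 hμ1, pow_zero, one_mul]
    rw [hb]
    exact hA.norm_balakrishnan_le hε0 hεγ hμ0 hμ1 b
  · rw [max_eq_right hμ0]
    obtain ⟨C, hC, hb⟩ := hA.bound ε hε0 hεγ
    refine ⟨C * ‖a‖ + ‖a‖, fun z hz => ?_⟩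
    have hz0 : 0 < ‖z‖ := norm_pos_iff.2 hz.1
    rw [neg_zero, Real.rpow_zero, mul_one]
    refine (norm_sub_le _ _).trans (add_le_add ?_ le_rfl)
    rw [norm_smul]
    calc ‖z‖ * ‖resolventOp A z a‖ ≤ ‖z‖ * (C / ‖z‖ * ‖a‖) := by
          gcongr
          exact (ContinuousLinearMap.le_opNorm _ _).trans (by gcongr; exact hb z hz)
      _ = C * ‖a‖ := by field_simp

theorem isSectorSymbol_genSymbol [CompleteSpace X] (hA : SectorialCondition A γ) (hα0 : 0 < α)
    (hα1 : α < 1) {μ : ℝ} (hμ1 : μ < 1) {a : X} (ha : a ∈ (fracPow A μ).domain) :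
    ∃ M : ℝ, IsSectorSymbol γ (α * (1 - max μ 0)) M (genSymbol A α a) := by
  have hγ : 0 < γ := by linarith [hA.angle_gt, Real.pi_pos]
  obtain ⟨ε, hε0, hε⟩ := exists_between (sub_pos.2 (mul_lt_of_lt_one_left hγ hα1))
  obtain ⟨C, hb⟩ := hA.norm_generator_resolvent_le hε0
    (hε.trans (sub_lt_self _ (by positivity))) hμ1 ha
  refine ⟨C, fun z hz => ?_, fun z hz => ?_⟩
  · have h1 : DifferentiableAt ℂ (fun z : ℂ => z ^ (α : ℂ)) z :=
      differentiableAt_id.cpow_const (closedSector_subset_slitPlane hA.angle_lt hz)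
    exact (differentiableAt_id.cpow_const (closedSector_subset_slitPlane hA.angle_lt hz)).smul
      ((h1.smul (hA.differentiableAt_resolventOp_cpow hα0 hα1 a hz)).sub_const a)
  · have hz0 : 0 < ‖z‖ := norm_pos_iff.2 hz.1
    have h1 := hb _ (cpow_mem_sector hα0 hα1 hA.angle_lt (by linarith) hz)
    rw [Complex.norm_cpow_real, ← Real.rpow_mul hz0.le] at h1
    rw [genSymbol, norm_smul, norm_cpow_sub_one,
      show α * (1 - max μ 0) - 1 = (α - 1) + α * -max μ 0 by ring, Real.rpow_add hz0,
      mul_left_comm]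
    gcongr

/-- `A⁻¹` turns the symbol of `A G(t) a` into that of `G(t) a`. -/
theorem solSymbol_eq (hA : SectorialCondition A γ) (hα0 : 0 < α) (hα1 : α < 1) (a : X) {z : ℂ}
    (hz : z ∈ closedSector γ) :
    solSymbol A α a z = (-resolventOp A 0) (genSymbol A α a z) := by
  have hγ : 0 < γ := by linarith [hA.angle_gt, Real.pi_pos]
  have h := resolventOp_eq_neg_zero (hA.sector_subset
    (cpow_mem_sector hα0 hα1 hA.angle_lt (mul_lt_of_lt_one_left hγ hα1) hz)) hA.zero_mem a
  rw [solSymbol, genSymbol, map_smul, neg_apply, ← h]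

end SectorialCondition

theorem memLp_of_norm_le_rpow {E : Type*} [NormedAddCommGroup E] {g : ℝ → E} {q : ℝ≥0∞}
    (hq : 1 ≤ q) (hq' : q ≠ ∞) {C δ T : ℝ}
    (hδ : δ * q.toReal < 1) (hg : AEStronglyMeasurable g (volume.restrict (Ioi 0)))
    (hT : 0 < T) (hb : ∀ t : ℝ, 0 < t → ‖g t‖ ≤ C * t ^ (-δ)) :
    MemLp g q (volume.restrict (Ioo 0 T)) := by
  have hm : AEStronglyMeasurable g (volume.restrict (Ioo 0 T)) :=
    hg.mono_measure (Measure.restrict_mono Ioo_subset_Ioi_self le_rfl)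
  have hpow : MemLp (fun t : ℝ => t ^ (-δ)) q (volume.restrict (Ioo 0 T)) := by
    have hm' : Measurable fun t : ℝ => t ^ (-δ) := by fun_prop
    rw [← integrable_norm_rpow_iff hm'.aestronglyMeasurable (by positivity) hq']
    have hi : IntegrableOn (fun t : ℝ => t ^ (-δ * q.toReal)) (Ioo 0 T) :=
      (intervalIntegrable_iff_integrableOn_Ioo_of_le hT.le).1
        (intervalIntegral.intervalIntegrable_rpow' (by linarith))
    refine (integrable_congr ?_).1 hi
    filter_upwards [self_mem_ae_restrict measurableSet_Ioo] with t ht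
    have ht0 : 0 < t := ht.1
    rw [Real.norm_of_nonneg (by positivity), ← Real.rpow_mul ht0.le]
  refine hpow.of_le_mul (c := C) hm ?_
  filter_upwards [self_mem_ae_restrict measurableSet_Ioo] with t ht
  have ht0 : 0 < t := ht.1
  rw [Real.norm_of_nonneg (by positivity)]
  exact hb t ht.1

end FracEvol
end

open FracEvol in
theorem theorem2p1 {X : Type*} [NormedAddCommGroup X] [NormedSpace ℂ X] [CompleteSpace X]
    (A : X →ₗ.[ℂ] X) (γ : ℝ) (hA : FracEvol.SectorialCondition A γ)
    (α : ℝ) (hα0 : 0 < α) (hα1 : α < 1)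
    (q : ℝ≥0∞) (hq : 1 ≤ q)
    (μ : ℝ) (hμ0 : 1 - (q⁻¹).toReal / α < μ) (hμ1 : μ < 1) :
    (∀ a : X,
      (∀ t : ℝ, 0 < t →
        FracEvol.ContourIntegrable γ (1 / ‖(t : ℂ)‖) (FracEvol.solIntegrand A α t a)) ∧
      MemLp (fun t : ℝ => FracEvol.solOp A γ α t a - a) ∞ (volume.restrict (Ioi 0))) ∧
    ∀ a ∈ (FracEvol.fracPow A μ).domain,
      (∀ T : ℝ, 0 < T → FracEvol.MemW α q T (fun t : ℝ => FracEvol.solOp A γ α t a - a)) ∧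
      ∃ hD : ∀ t : ℝ, 0 < t → FracEvol.solOp A γ α t a ∈ A.domain,
        ∀ T : ℝ, 0 < T → ∀ w : ℝ → X,
          (∀ (t : ℝ) (ht : t ∈ Ioo 0 T), w t = A ⟨FracEvol.solOp A γ α t a, hD t ht.1⟩) →
          FracEvol.IsFracDeriv α q T (fun t : ℝ => FracEvol.solOp A γ α t a - a) w := by
  have hγ0 := hA.angle_gt
  have hγ := hA.angle_lt
  have hγ' : 0 < γ := by linarith [Real.pi_pos]
  refine ⟨fun a => ?_, fun a ha => ?_⟩
  · obtain ⟨M, hS⟩ := hA.isSectorSymbol_solSymbol hα0 hα1 a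
    refine ⟨fun t ht => ?_, ?_⟩
    · have h := hS.contourIntegrable hγ0 hγ zero_lt_one ht (one_div_pos.2 ht)
      rw [Complex.norm_real, Real.norm_of_nonneg ht.le]
      convert h using 1
      ext z
      rw [solIntegrand, solSymbol, mul_smul]
    · obtain ⟨C, hC⟩ := hS.norm_hankel_le hγ0 hγ zero_lt_one
      have heq : (fun t : ℝ => hankel γ (solSymbol A α a) t - a)
          =ᵐ[volume.restrict (Ioi 0)] fun t : ℝ => solOp A γ α t a - a := by
        filter_upwards [self_mem_ae_restrict measurableSet_Ioi] with t ht
        rw [solOp_eq_hankel A γ α ht]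
      refine MemLp.ae_eq heq (memLp_top_of_bound ((hS.aestronglyMeasurable_hankel hγ0 hγ
        zero_lt_one).sub aestronglyMeasurable_const) (C + ‖a‖) ?_)
      filter_upwards [self_mem_ae_restrict measurableSet_Ioi] with t ht
      have h := hC t ht
      rw [neg_zero, Real.rpow_zero, mul_one] at h
      exact (norm_sub_le _ _).trans (add_le_add h le_rfl)
  · obtain ⟨M, hS⟩ := hA.isSectorSymbol_solSymbol hα0 hα1 a
    obtain ⟨M', hT⟩ := hA.isSectorSymbol_genSymbol hα0 hα1 hμ1 ha
    set δ := α * (1 - max μ 0) with hδ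
    have hδα : δ ≤ α := mul_le_of_le_one_right hα0.le (by linarith [le_max_right μ 0])
    have hδ1 : δ < 1 := hδα.trans_lt hα1
    -- for `q = ∞` the condition on `μ` would be `1 < μ < 1`
    have hq' : q ≠ ∞ := by
      rintro rfl
      simp only [ENNReal.inv_top, ENNReal.toReal_zero, zero_div, sub_zero] at hμ0
      linarith
    have hqpos : 0 < q.toReal := ENNReal.toReal_pos (by positivity) hq'
    have hδq : δ * q.toReal < 1 := by
      have h1 : 1 - max μ 0 < q.toReal⁻¹ / α := by
        rw [ENNReal.toReal_inv] at hμ0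
        linarith [le_max_left μ 0]
      rw [lt_div_iff₀ hα0, mul_comm] at h1
      calc δ * q.toReal < q.toReal⁻¹ * q.toReal := by gcongr
        _ = 1 := inv_mul_cancel₀ hqpos.ne'
    have hG : ∀ t : ℝ, 0 < t →
        solOp A γ α t a = -resolventOp A 0 (hankel γ (genSymbol A α a) t) := by
      intro t ht
      rw [solOp_eq_hankel A γ α ht, hankel_congr hγ' hγ ht
        (fun z hz => hA.solSymbol_eq hα0 hα1 a hz), hT.hankel_comp_clm hγ0 hγ hδ1 _ ht]
      rfl
    have hR0 := isResolventAt_resolventOp hA.zero_mem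
    have hD : ∀ t : ℝ, 0 < t → solOp A γ α t a ∈ A.domain := by
      intro t ht
      rw [hG t ht]
      exact A.domain.neg_mem (hR0.1 _).1
    have hAG : ∀ (t : ℝ) (ht : 0 < t),
        A ⟨solOp A γ α t a, hD t ht⟩ = hankel γ (genSymbol A α a) t := by
      intro t ht
      obtain ⟨h, hx⟩ := hR0.1 (hankel γ (genSymbol A α a) t)
      have : (⟨solOp A γ α t a, hD t ht⟩ : A.domain)
          = -⟨resolventOp A 0 (hankel γ (genSymbol A α a) t), h⟩ := Subtype.ext (hG t ht)
      rw [this, LinearPMap.map_neg]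
      rwa [zero_smul, zero_sub] at hx
    have hJ : ∀ t : ℝ, 0 < t →
        solOp A γ α t a - a = fracIntegral α (hankel γ (genSymbol A α a)) t := by
      intro t ht
      rw [hT.fracIntegral_hankel hγ0 hγ hδ1 hα0 hα1 ht,
        hankel_congr hγ' hγ ht (fun z hz => cpow_neg_smul_genSymbol A α a hz.1),
        hS.hankel_sub (isSectorSymbol_inv_smul γ a) hγ0 hγ zero_lt_one zero_lt_one ht,
        hankel_inv_smul hγ0 hγ ht, solOp_eq_hankel A γ α ht]
    have hmain : ∀ T : ℝ, 0 < T → ∀ w : ℝ → X,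
        (∀ (t : ℝ) (ht : t ∈ Ioo 0 T), w t = A ⟨solOp A γ α t a, hD t ht.1⟩) →
        IsFracDeriv α q T (fun t : ℝ => solOp A γ α t a - a) w := by
      intro T hTpos w hw
      have hw' : ∀ t ∈ Ioo 0 T, hankel γ (genSymbol A α a) t = w t := fun t ht => by
        rw [hw t ht, hAG t ht.1]
      constructor
      · obtain ⟨C, hC⟩ := hT.norm_hankel_le hγ0 hγ hδ1
        refine MemLp.ae_eq ?_ (memLp_of_norm_le_rpow hq hq' hδq
          (hT.aestronglyMeasurable_hankel hγ0 hγ hδ1) hTpos hC)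
        filter_upwards [self_mem_ae_restrict measurableSet_Ioo] with t ht
        exact hw' t ht
      · filter_upwards [self_mem_ae_restrict measurableSet_Ioo] with t ht
        rw [hJ t ht.1, fracIntegral, fracIntegral, intervalIntegral.integral_of_le ht.1.le,
          intervalIntegral.integral_of_le ht.1.le]
        congr 1
        refine setIntegral_congr_fun measurableSet_Ioc fun s hs => ?_
        simp only [hw' s ⟨hs.1, hs.2.trans_lt ht.2⟩]
    exact ⟨fun T hTpos => ⟨fun t => if ht : 0 < t then A ⟨solOp A γ α t a, hD t ht⟩ else 0,
      hmain T hTpos _ fun t ht => dif_pos ht.1⟩, hD, hmain⟩
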